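/- Let $p$ be a prime, let $k$ be a closed subfield of $\mathbb{C}_p$ with the restricted valuation $|\cdot|$, and let $V$ be a Banach $k$-vector space, i.e. a $k$-vector space that is complete for a norm $\|\cdot\|$ satisfying $\|v_0-v_1\|\le\max\{\|v_0\|,\|v_1\|\}$ and $\|cv\|=|c|\,\|v\|$. For $S\subseteq V$ let $\langle S\rangle$ be the closure of the $k$-linear span of $S$, and let $\operatorname{rank}(V)$ be the least cardinality of a subset $S\subseteq V$ with $\langle S\rangle=V$. For a set $E$ let $C_0(E,k)$ be the set of functions $c\colon E\to k$ such that $\{e\in E : |c(e)|\ge\varepsilon\}$ is finite for every $\varepsilon>0$, with norm $\|c\|=\sup_{e\in E}|c(e)|$ (equal to $0$ if $E=\emptyset$). A Banach $k$-vector space $W$ is *free* if it has an orthonormal Schauder basis, i.e. a subset $E\subseteq W$ such that $\|e\|=1$ for all $e\in E$, $\|\sum_{e\in E}c(e)e\|=\|c\|$ for all $c\in C_0(E,k)$, and every $w\in W$ equals $\sum_{e\in E}c(e)e$ for some $c\in C_0(E,k)$. The space $V$ is *almost free* if $\langle S\rangle$, with the restricted norm, is free for every $S\subseteq V$ with $\#S<\operatorname{rank}(V)$.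 A filter is *$\lambda$-complete* if it is closed under intersections of non-empty families of fewer than $\lambda$ of its members. A cardinal $\kappa$ is *$\aleph_1$-strongly compact* if $\kappa\ge\aleph_1$ and every proper $\kappa$-complete filter on $\kappa$ is contained in an $\aleph_1$-complete ultrafilter on $\kappa$. Suppose that $\#V=\operatorname{rank}(V)$ and that $\operatorname{rank}(V)$ is $\aleph_1$-strongly compact. Then $V$ is free if and only if $V$ is almost free. -/

import Mathlib

open Cardinal Topology

universe u v

/-- `⟨S⟩`: the closure of the `k`-linear subspace generated by `S`. -/
def closedSpan (k : Type v) [NormedField k] {V : Type u} [NormedAddCommGroup V] [NormedSpace k V]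
    (S : Set V) : Submodule k V :=
  (Submodule.span k S).topologicalClosure

/-- The rank of a Banach space: the least cardinality of a subset `S` with `⟨S⟩ = V`. -/
noncomputable def banachRank (k : Type v) [NormedField k] (V : Type u) [NormedAddCommGroup V]
    [NormedSpace k V] : Cardinal.{u} :=
  sInf {κ : Cardinal.{u} | ∃ S : Set V, #S = κ ∧ closedSpan k S = ⊤}

/-- `E` is an orthonormal Schauder basis of `V`. An element of `C₀(E, k)` is a function
`c : E → k` tending to `0` along the cofinite filter, with norm `⨆ e, ‖c e‖` (which is `0` for
empty `E`). The sum in `norm_sum` always exists when `V` is complete and ultrametric. -/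
structure IsOrthonormalSchauderBasis (k : Type v) [NormedField k] {V : Type u}
    [NormedAddCommGroup V] [NormedSpace k V] (E : Set V) : Prop where
  norm_eq_one : ∀ e ∈ E, ‖e‖ = 1
  norm_sum : ∀ c : E → k, Filter.Tendsto c Filter.cofinite (𝓝 0) →
    ∃ s : V, HasSum (fun e : E => c e • (e : V)) s ∧ ‖s‖ = ⨆ e : E, ‖c e‖
  exists_coeff : ∀ v : V, ∃ c : E → k, Filter.Tendsto c Filter.cofinite (𝓝 0) ∧
    HasSum (fun e : E => c e • (e : V)) v

/-- `V` is free: it admits an orthonormal Schauder basis. -/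
def IsFreeBanach (k : Type v) [NormedField k] (V : Type u) [NormedAddCommGroup V]
    [NormedSpace k V] : Prop :=
  ∃ E : Set V, IsOrthonormalSchauderBasis k E

/-- `V` is `κ`-free: every `⟨S⟩` with `#S < κ` is free (for the restricted norm). -/
def IsCardinalFreeBanach (k : Type v) [NormedField k] (V : Type u) [NormedAddCommGroup V]
    [NormedSpace k V] (κ : Cardinal.{u}) : Prop :=
  ∀ S : Set V, #S < κ → IsFreeBanach k (closedSpan k S)

/-- `V` is almost free: it is `rank(V)`-free. -/
def IsAlmostFreeBanach (k : Type v) [NormedField k] (V : Type u) [NormedAddCommGroup V]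
    [NormedSpace k V] : Prop :=
  IsCardinalFreeBanach k V (banachRank k V)

/-- `κ` is `ℵ₁`-strongly compact: `κ` is uncountable and every proper `κ`-complete filter on a
set of cardinality `κ` is contained in an `ℵ₁`-complete ultrafilter. Here `CardinalInterFilter F c`
says that `F` is closed under intersections of fewer than `c` members, and `U ≤ F` that `U`
contains `F`. -/
def IsAleph1StronglyCompact (κ : Cardinal.{u}) : Prop :=
  ℵ₁ ≤ κ ∧ ∀ F : Filter κ.out, F.NeBot → CardinalInterFilter F κ →
    ∃ U : Ultrafilter κ.out, (U : Filter κ.out) ≤ F ∧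
      CardinalInterFilter (U : Filter κ.out) ℵ₁

/-! ### Orthonormality and freeness relative to a subspace -/

section Orthonormal

variable {k : Type v} [NormedField k] {V : Type u} [NormedAddCommGroup V] [NormedSpace k V]

/-! The engine is a relative form of Gruson's theorem over a complete separable ultrametric field:
if `W / N` embeds isometrically, in the sense of `IsCoordinate`, into null families on some index
set, then `W` is free over `N` (`IsCoordinate.freeOver_top`). Countably generated pieces are handled
by Gaussian elimination with a pivot of maximal norm; separability cuts an arbitrary space into a
chain of such pieces. As coordinates restrict, freeness is inherited by closed subspaces
(`IsFreeBanach.submodule`) and by intermediate spaces (`FreeOver.of_le`). The first gives free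
implies almost free.

For the converse let κ be the rank. If κ is regular, well-order `V` in type κ and extend the filter
of sets with complement smaller than κ to a countably complete ultrafilter. Every vector lies in
almost every closed span of an initial segment, and these spans are free. The ultraproduct of their
bases indexes coordinates on `V`: a `k`-valued coordinate is almost everywhere constant because `k`
is second countable. Gruson's theorem then yields a basis, whether or not the ultraproduct itself
sits in `V`.

If κ is singular, the argument is Shelah's singular compactness. Freeness at cardinality μ⁺ puts
every set of size at most μ inside a pure set of that size (`exists_isPure`). Purity lets bases be
extended along a matrix of sets, and an exchange of countable supports makes the limit spaces a
chain with free successive quotients.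

Finally `k` is separable because the numbers algebraic over ℚ are dense in ℂ_p. -/

omit [NormedField k] [NormedSpace k V] in
theorem norm_sub_le_max' [IsUltrametricDist V] (x y : V) : ‖x - y‖ ≤ max ‖x‖ ‖y‖ := by
  rw [sub_eq_add_neg]
  exact (IsUltrametricDist.norm_add_le_max x (-y)).trans (by rw [norm_neg])

/-- The vectors of `E` have norm at most one and are orthonormal modulo `N`. -/
def OrthonormalOver (N : Submodule k V) (E : Set V) : Prop :=
  (∀ e ∈ E, ‖e‖ ≤ 1) ∧ ∀ n ∈ N, ∀ b ∈ Finsupp.supported k k E, ∀ e : V,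
    ‖b e‖ ≤ ‖n + Finsupp.linearCombination k (id : V → V) b‖

/-- `M` is topologically generated by `N` and a family of `M` that is orthonormal modulo `N`. -/
def FreeOver (N M : Submodule k V) : Prop :=
  ∃ E : Set V, E ⊆ M ∧ OrthonormalOver N E ∧ M ≤ (N ⊔ Submodule.span k E).topologicalClosure

namespace OrthonormalOver

variable {N N' : Submodule k V} {E E' : Set V}

theorem empty : OrthonormalOver N (∅ : Set V) := by
  refine ⟨by simp, fun n _ b hb e => ?_⟩
  have : b = 0 := by simpa using hb
  simp [this]

theorem mono_right (h : OrthonormalOver N E) (hE : E' ⊆ E) : OrthonormalOver N E' :=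
  ⟨fun e he => h.1 e (hE he), fun n hn b hb => h.2 n hn b (Finsupp.supported_mono hE hb)⟩

theorem topologicalClosure (h : OrthonormalOver N E) :
    OrthonormalOver N.topologicalClosure E := by
  refine ⟨h.1, fun n hn b hb e => ?_⟩
  refine closure_minimal (s := (N : Set V))
    (t := {n | ‖b e‖ ≤ ‖n + Finsupp.linearCombination k (id : V → V) b‖})
    (fun n hn => h.2 n hn b hb e) ?_ hn
  exact isClosed_le continuous_const (by fun_prop)

theorem linearCombination_mem {b : V →₀ k} (hE : E ⊆ N) (hb : b ∈ Finsupp.supported k k E) :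
    Finsupp.linearCombination k (id : V → V) b ∈ N := by
  have : Submodule.span k E ≤ N := Submodule.span_le.2 hE
  refine this ?_
  simpa using (Finsupp.mem_span_image_iff_linearCombination k (v := id) (s := E)).2 ⟨b, hb, rfl⟩

variable [IsUltrametricDist V]

theorem norm_linearCombination_le (h : ∀ e ∈ E, ‖e‖ ≤ 1) {b : V →₀ k}
    (hb : b ∈ Finsupp.supported k k E) {r : ℝ} (hr : 0 ≤ r) (hbr : ∀ e, ‖b e‖ ≤ r) :
    ‖Finsupp.linearCombination k (id : V → V) b‖ ≤ r := by
  rw [Finsupp.linearCombination_apply, Finsupp.sum]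
  refine IsUltrametricDist.norm_sum_le_of_forall_le_of_nonneg hr fun e he => ?_
  rw [norm_smul]
  calc ‖b e‖ * ‖id e‖ ≤ r * 1 := mul_le_mul (hbr e) (h e (hb he)) (norm_nonneg _) hr
    _ = r := mul_one r

/-- Transitivity of relative freeness rests on this. Orthonormality of `E'` modulo `N'` bounds the
`E'`-part by the whole vector, so the ultrametric inequality bounds the remaining part too. -/
theorem union [IsUltrametricDist k] (h : OrthonormalOver N E) (hE : E ⊆ N') (hN : N ≤ N')
    (h' : OrthonormalOver N' E') : OrthonormalOver N (E ∪ E') := by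
  classical
  refine ⟨fun e he => he.elim (h.1 e) (h'.1 e), fun n hn b hb => ?_⟩
  rw [Finsupp.supported_union] at hb
  obtain ⟨b₁, hb₁, b₂, hb₂, rfl⟩ := Submodule.mem_sup.1 hb
  rw [map_add, ← add_assoc]
  set x := Finsupp.linearCombination k (id : V → V) b₁
  set y := Finsupp.linearCombination k (id : V → V) b₂
  have h2 : ∀ e, ‖b₂ e‖ ≤ ‖n + x + y‖ :=
    h'.2 _ (N'.add_mem (hN hn) (linearCombination_mem hE hb₁)) b₂ hb₂
  have hy : ‖y‖ ≤ ‖n + x + y‖ := norm_linearCombination_le h'.1 hb₂ (norm_nonneg _) h2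
  have hx : ‖n + x‖ ≤ ‖n + x + y‖ := by
    have : n + x = (n + x + y) - y := by abel
    calc ‖n + x‖ = ‖(n + x + y) - y‖ := by rw [← this]
      _ ≤ _ := (norm_sub_le_max' _ _).trans (max_le le_rfl hy)
  intro e
  exact (IsUltrametricDist.norm_add_le_max _ _).trans
    (max_le ((h.2 n hn b₁ hb₁ e).trans hx) (h2 e))

omit [IsUltrametricDist V] in
theorem iUnion {ι : Type*} [Nonempty ι] {E : ι → Set V} (hd : Directed (· ⊆ ·) E)
    (h : ∀ i, OrthonormalOver N (E i)) : OrthonormalOver N (⋃ i, E i) := by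
  refine ⟨fun e he => ?_, fun n hn b hb => ?_⟩
  · obtain ⟨i, hi⟩ := Set.mem_iUnion.1 he
    exact (h i).1 e hi
  · have hb' : (b.support : Set V) ⊆ ⋃ i, E i := hb
    obtain ⟨i, hi⟩ := hd.exists_mem_subset_of_finset_subset_biUnion hb'
    exact (h i).2 n hn b hi

omit [IsUltrametricDist V] in
theorem map {W : Type*} [NormedAddCommGroup W] [NormedSpace k W] {N : Submodule k W} {E : Set W}
    (f : W →ₗᵢ[k] V) (h : OrthonormalOver N E) :
    OrthonormalOver (N.map f.toLinearMap) (f '' E) := by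
  classical
  refine ⟨?_, ?_⟩
  · rintro _ ⟨e, he, rfl⟩
    simpa using h.1 e he
  · rintro _ ⟨n, hn, rfl⟩ b hb e
    rw [← Finsupp.lmapDomain_supported] at hb
    obtain ⟨c, hc, rfl⟩ := hb
    by_cases he : e ∈ Set.range f
    · obtain ⟨w, rfl⟩ := he
      have h1 := h.2 n hn c hc w
      rw [← f.norm_map, map_add] at h1
      simp only [Finsupp.lmapDomain_apply]
      rw [Finsupp.mapDomain_apply f.injective, Finsupp.linearCombination_mapDomain]
      have h2 : Finsupp.linearCombination k ((id : V → V) ∘ f) c =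
          f (Finsupp.linearCombination k (id : W → W) c) := by
        simp [Finsupp.linearCombination_apply, Finsupp.sum]
      rw [h2]
      exact h1
    · rw [Finsupp.lmapDomain_apply, Finsupp.mapDomain_of_notMem_range _ _ he]
      simp

end OrthonormalOver

theorem FreeOver.topologicalClosure {N M : Submodule k V} (h : FreeOver N M) :
    FreeOver N.topologicalClosure M.topologicalClosure := by
  obtain ⟨E, hE, ho, hM⟩ := h
  refine ⟨E, hE.trans (Submodule.le_topologicalClosure M), ho.topologicalClosure, ?_⟩
  refine Submodule.topologicalClosure_minimal _ (hM.trans ?_)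
    (Submodule.isClosed_topologicalClosure _)
  exact Submodule.topologicalClosure_mono
    (sup_le_sup_right (Submodule.le_topologicalClosure N) _)

theorem mem_topologicalClosure_of_forall_norm_sub_le {P : Submodule k V} {m : V}
    (h : ∀ r : ℝ, 0 < r → ∃ x ∈ P.topologicalClosure, ‖m - x‖ ≤ r) :
    m ∈ P.topologicalClosure := by
  refine (Submodule.isClosed_topologicalClosure P).closure_subset (Metric.mem_closure_iff.2 ?_)
  intro ε hε
  obtain ⟨x, hx, hmx⟩ := h (ε / 2) (by positivity)
  exact ⟨x, hx, by rw [dist_eq_norm]; linarith⟩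

theorem FreeOver.map {W : Type*} [NormedAddCommGroup W] [NormedSpace k W] {N M : Submodule k W}
    (f : W →ₗᵢ[k] V) (h : FreeOver N M) :
    FreeOver (N.map f.toLinearMap) (M.map f.toLinearMap) := by
  obtain ⟨E, hE, ho, hM⟩ := h
  refine ⟨f '' E, Set.image_mono hE, ho.map f, ?_⟩
  rintro _ ⟨m, hm, rfl⟩
  rw [show Submodule.span k (f '' E) = (Submodule.span k E).map f.toLinearMap by
    rw [Submodule.map_span]; rfl, ← Submodule.map_sup]
  exact image_closure_subset_closure_image f.continuous ⟨m, hM hm, rfl⟩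

theorem subset_closedSpan (S : Set V) : S ⊆ closedSpan k S :=
  Submodule.subset_span.trans (Submodule.le_topologicalClosure _)

theorem closedSpan_le {S : Set V} {T : Set V} :
    closedSpan k S ≤ closedSpan k T ↔ S ⊆ closedSpan k T :=
  ⟨fun h => (subset_closedSpan S).trans h, fun h =>
    Submodule.topologicalClosure_minimal _ (Submodule.span_le.2 h)
      (Submodule.isClosed_topologicalClosure _)⟩

theorem closedSpan_mono {S T : Set V} (h : S ⊆ T) : closedSpan k S ≤ closedSpan k T :=
  closedSpan_le.2 (h.trans (subset_closedSpan T))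

theorem closedSpan_isClosed (S : Set V) : IsClosed (closedSpan k S : Set V) :=
  Submodule.isClosed_topologicalClosure _

theorem closedSpan_union_eq (N : Submodule k V) (S : Set V) :
    closedSpan k (N ∪ S : Set V) = (N ⊔ Submodule.span k S).topologicalClosure := by
  rw [closedSpan, Submodule.span_union, Submodule.span_eq]

/-- An element of a closed span lies in the closed span of a countable subset. -/
theorem exists_countable_mem_closedSpan {S : Set V} {v : V} (hv : v ∈ closedSpan k S) :
    ∃ T ⊆ S, T.Countable ∧ v ∈ closedSpan k T := by
  obtain ⟨x, hx, hlim⟩ := mem_closure_iff_seq_limit.1 hv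
  have h : ∀ n, ∃ T : Finset V, (T : Set V) ⊆ S ∧ x n ∈ Submodule.span k (T : Set V) :=
    fun n => Submodule.mem_span_finite_of_mem_span (hx n)
  choose T hT hxT using h
  refine ⟨⋃ n, (T n : Set V), Set.iUnion_subset hT,
    Set.countable_iUnion fun n => (T n).countable_toSet, ?_⟩
  exact mem_closure_of_tendsto hlim (Filter.Eventually.of_forall fun n =>
    Submodule.span_mono (Set.subset_iUnion (fun n => (T n : Set V)) n) (hxT n))

/-- Composing a well-ordered chain of orthonormal extensions. -/
theorem FreeOver.chain [IsUltrametricDist k] [IsUltrametricDist V] {ι : Type*}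
    [LinearOrder ι] [WellFoundedLT ι] (A : Set V) (S : ι → Set V)
    (h : ∀ i, FreeOver (closedSpan k (A ∪ ⋃ j < i, S j)) (closedSpan k (A ∪ ⋃ j ≤ i, S j))) :
    FreeOver (closedSpan k A) (closedSpan k (A ∪ ⋃ i, S i)) := by
  choose E hES ho hd using h
  -- Limit stages cost nothing: each orthonormality inequality involves finitely many vectors, hence
  -- passes to directed unions.
  have key : ∀ i, OrthonormalOver (closedSpan k A) (⋃ j ≤ i, E j) := by
    intro i
    induction i using WellFoundedLT.induction with
    | ind i ih =>
      have h1 : OrthonormalOver (closedSpan k A) (⋃ j < i, E j) := by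
        by_cases hi : Nonempty (Set.Iio i)
        · have := OrthonormalOver.iUnion (N := closedSpan k A)
            (E := fun j : Set.Iio i => ⋃ l ≤ (j : ι), E l) ?_ (fun j => ih j j.2)
          · refine this.mono_right ?_
            refine Set.iUnion₂_subset fun j hj => ?_
            exact (Set.subset_iUnion₂ (s := fun l (_ : l ≤ j) => E l) j le_rfl).trans
              (Set.subset_iUnion (fun j : Set.Iio i => ⋃ l ≤ (j : ι), E l) ⟨j, hj⟩)
          · refine Monotone.directed_le (fun a b hab => ?_)
            exact Set.iUnion₂_subset fun l hl =>
              Set.subset_iUnion₂ (s := fun l (_ : l ≤ (b : ι)) => E l) l (hl.trans hab)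
        · have : (⋃ j < i, E j) = ∅ := by
            simp only [Set.iUnion_eq_empty]
            exact fun j hj => (hi ⟨j, hj⟩).elim
          rw [this]
          exact OrthonormalOver.empty
      refine (h1.union (N' := closedSpan k (A ∪ ⋃ j < i, S j)) ?_
        (closedSpan_mono Set.subset_union_left) (ho i)).mono_right ?_
      · refine Set.iUnion₂_subset fun j hj => (hES j).trans ?_
        exact closedSpan_mono (Set.union_subset_union_right _ (Set.iUnion₂_subset fun l hl =>
          Set.subset_iUnion₂ (s := fun j (_ : j < i) => S j) l (hl.trans_lt hj)))
      · refine Set.iUnion₂_subset fun j hj => ?_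
        rcases hj.lt_or_eq with hj | rfl
        · exact (Set.subset_iUnion₂ (s := fun j (_ : j < i) => E j) j hj).trans
            Set.subset_union_left
        · exact Set.subset_union_right
  set P := (closedSpan k A ⊔ Submodule.span k (⋃ i, E i)).topologicalClosure with hP
  have hAP : closedSpan k A ≤ P := le_sup_left.trans (Submodule.le_topologicalClosure _)
  have hEP : ∀ i, Submodule.span k (E i) ≤ P := fun i =>
    ((Submodule.span_mono (Set.subset_iUnion E i)).trans le_sup_right).trans
      (Submodule.le_topologicalClosure _)
  have hPc : IsClosed (P : Set V) := Submodule.isClosed_topologicalClosure _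
  have hSP : ∀ i, S i ⊆ P := by
    intro i
    induction i using WellFoundedLT.induction with
    | ind i ih =>
      have h1 : closedSpan k (A ∪ ⋃ j < i, S j) ≤ P := by
        refine Submodule.topologicalClosure_minimal _ (Submodule.span_le.2 ?_) hPc
        exact Set.union_subset ((subset_closedSpan A).trans hAP) (Set.iUnion₂_subset ih)
      have h2 := (hd i).trans (Submodule.topologicalClosure_minimal _ (sup_le h1 (hEP i)) hPc)
      exact (Set.subset_iUnion₂ (s := fun j (_ : j ≤ i) => S j) i le_rfl).trans
        (Set.subset_union_right.trans ((subset_closedSpan _).trans h2))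
  refine ⟨⋃ i, E i, ?_, ?_, ?_⟩
  · refine Set.iUnion_subset fun i => (hES i).trans (closedSpan_mono ?_)
    exact Set.union_subset_union_right _
      (Set.iUnion₂_subset fun j _ => Set.subset_iUnion S j)
  · by_cases hι : Nonempty ι
    · refine (OrthonormalOver.iUnion (E := fun i => ⋃ j ≤ i, E j) ?_ key).mono_right ?_
      · refine Monotone.directed_le (fun a b hab => ?_)
        exact Set.iUnion₂_subset fun l hl =>
          Set.subset_iUnion₂ (s := fun l (_ : l ≤ b) => E l) l (hl.trans hab)
      · exact Set.iUnion_mono fun i => Set.subset_iUnion₂ (s := fun l (_ : l ≤ i) => E l) i le_rfl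
    · have : IsEmpty ι := not_nonempty_iff.1 hι
      rw [Set.iUnion_of_empty]
      exact OrthonormalOver.empty
  · refine Submodule.topologicalClosure_minimal _ (Submodule.span_le.2 ?_) hPc
    exact Set.union_subset ((subset_closedSpan A).trans hAP) (Set.iUnion_subset hSP)

end Orthonormal

/-! ### Null-family coordinates and Gruson's theorem -/

section Coordinates

variable {k : Type v} [NormedField k] {W : Type u} [NormedAddCommGroup W] [NormedSpace k W]

/-- `φ` embeds `W / N` isometrically, in a strong sense, into a space of null families. -/
structure IsCoordinate (N : Submodule k W) {I : Type*} (φ : W →ₗ[k] I → k) : Prop where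
  tendsto : ∀ m, Filter.Tendsto (φ m) Filter.cofinite (𝓝 0)
  norm_le : ∀ m i, ‖φ m i‖ ≤ ‖m‖
  ker : ∀ n ∈ N, φ n = 0
  approx : ∀ m (r : ℝ), 0 < r → (∀ i, ‖φ m i‖ ≤ r) → ∃ n ∈ N, ‖m - n‖ ≤ r

/-- Supplies pivots: only finitely many entries are at least as large as a given nonzero one. -/
theorem exists_max_norm {I : Type*} {x : I → k} (hx : Filter.Tendsto x Filter.cofinite (𝓝 0))
    {T : Set I} (h : ∃ i ∈ T, x i ≠ 0) : ∃ i ∈ T, x i ≠ 0 ∧ ∀ j ∈ T, ‖x j‖ ≤ ‖x i‖ := by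
  obtain ⟨i₀, hi₀, hne⟩ := h
  have hpos : 0 < ‖x i₀‖ := norm_pos_iff.2 hne
  have hfin : {j | ‖x i₀‖ ≤ ‖x j‖}.Finite := by
    have := (tendsto_zero_iff_norm_tendsto_zero.1 hx).eventually (gt_mem_nhds hpos)
    simpa [Filter.eventually_cofinite] using this
  obtain ⟨i, ⟨hi, hiT⟩, hmax⟩ := Set.exists_max_image ({j | ‖x i₀‖ ≤ ‖x j‖} ∩ T)
    (fun j => ‖x j‖) (hfin.inter_of_left T) ⟨i₀, le_refl ‖x i₀‖, hi₀⟩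
  refine ⟨i, hiT, norm_pos_iff.1 (hpos.trans_le hi), fun j hj => ?_⟩
  rcases le_total ‖x i₀‖ ‖x j‖ with h | h
  · exact hmax j ⟨h, hj⟩
  · exact h.trans hi

theorem finite_setOf_lt_norm {I : Type*} {x : I → k}
    (hx : Filter.Tendsto x Filter.cofinite (𝓝 0)) {r : ℝ} (hr : 0 < r) :
    {j | r < ‖x j‖}.Finite := by
  have := (tendsto_zero_iff_norm_tendsto_zero.1 hx).eventually (gt_mem_nhds hr)
  rw [Filter.eventually_cofinite] at this
  exact this.subset fun j hj => not_lt.2 (le_of_lt hj)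

theorem countable_support {I : Type*} {x : I → k}
    (hx : Filter.Tendsto x Filter.cofinite (𝓝 0)) : {j | x j ≠ 0}.Countable := by
  have h : {j | x j ≠ 0} ⊆ ⋃ n : ℕ, {j | 1 / ((n : ℝ) + 1) < ‖x j‖} := by
    intro j hj
    obtain ⟨n, hn⟩ := exists_nat_one_div_lt (norm_pos_iff.2 hj)
    exact Set.mem_iUnion.2 ⟨n, hn⟩
  exact (Set.countable_iUnion fun n =>
    (finite_setOf_lt_norm hx Nat.one_div_pos_of_nat).countable).mono h

/-- Löwenheim–Skolem closing-off: iterate ω times; a finite subset of the union already lies in some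
stage. -/
theorem exists_countable_closed {I : Type*} (T : Finset I → Set I) (hT : ∀ F, (T F).Countable)
    (i : I) : ∃ C : Set I, C.Countable ∧ i ∈ C ∧ ∀ F : Finset I, (F : Set I) ⊆ C → T F ⊆ C := by
  let next : Set I → Set I := fun C => C ∪ ⋃ F ∈ {F : Finset I | (F : Set I) ⊆ C}, T F
  have hnext : ∀ C : Set I, C.Countable → (next C).Countable := by
    intro C hC
    refine hC.union (Set.Countable.biUnion ?_ fun F _ => hT F)
    have := (Set.countable_ofPred_finite_subset hC).preimage
      (Finset.coe_injective (α := I))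
    exact this.mono fun F hF => show (F : Set I).Finite ∧ (F : Set I) ⊆ C from ⟨F.finite_toSet, hF⟩
  let C : ℕ → Set I := fun n => next^[n] {i}
  have hC : ∀ n, C (n + 1) = next (C n) := fun n => Function.iterate_succ_apply' next n {i}
  have hmono : Monotone C := monotone_nat_of_le_succ fun n => by
    rw [hC]; exact Set.subset_union_left
  refine ⟨⋃ n, C n, Set.countable_iUnion fun n => ?_, Set.mem_iUnion.2 ⟨0, rfl⟩, fun F hF => ?_⟩
  · induction n with
    | zero => exact Set.countable_singleton i
    | succ n ih => rw [hC]; exact hnext _ ih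
  · obtain ⟨n, hn⟩ := hmono.directed_le.exists_mem_subset_of_finset_subset_biUnion hF
    refine Set.Subset.trans ?_ (Set.subset_iUnion C (n + 1))
    rw [hC]
    exact (Set.subset_biUnion_of_mem (u := T) (s := {F : Finset I | (F : Set I) ⊆ C n}) hn).trans
      Set.subset_union_right

/-- If `‖c - d‖ < ‖c‖` then `‖d‖ = ‖c‖`, so a dense subset already takes every nonzero norm value.
-/
theorem countable_range_norm [IsUltrametricDist k] [TopologicalSpace.SeparableSpace k] :
    (Set.range (norm : k → ℝ)).Countable := by
  obtain ⟨D, hD, hdense⟩ := TopologicalSpace.exists_countable_dense k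
  refine ((hD.image norm).insert 0).mono ?_
  rintro _ ⟨c, rfl⟩
  by_cases hc : c = 0
  · simp [hc]
  · obtain ⟨d, hd, hcd⟩ := hdense.exists_dist_lt c (norm_pos_iff.2 hc)
    refine Or.inr ⟨d, hd, le_antisymm ?_ ?_⟩
    · have : d = c - (c - d) := by abel
      rw [this]
      rw [dist_eq_norm] at hcd
      exact (norm_sub_le_max' _ _).trans (max_le le_rfl hcd.le)
    · by_contra hlt
      have h1 : c = (c - d) + d := by abel
      have h2 := IsUltrametricDist.norm_add_le_max (c - d) d
      rw [← h1] at h2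
      rw [dist_eq_norm] at hcd
      exact absurd h2 (not_le.2 (max_lt hcd (not_le.1 hlt)))

/-- The vectors whose coordinates vanish outside `J`. -/
def coordinateSubmodule {I : Type*} (φ : W →ₗ[k] I → k) (J : Set I) : Submodule k W where
  carrier := {m | ∀ i ∉ J, φ m i = 0}
  zero_mem' := by simp
  add_mem' := fun ha hb i hi => by simp [ha i hi, hb i hi]
  smul_mem' := fun c a ha i hi => by simp [ha i hi]

theorem coordinateSubmodule_mono {I : Type*} (φ : W →ₗ[k] I → k) {J J' : Set I} (h : J ⊆ J') :
    coordinateSubmodule φ J ≤ coordinateSubmodule φ J' :=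
  fun _ hm i hi => hm i fun hJ => hi (h hJ)

/-- Vectors with small coordinates outside `J` are close to vectors supported on `J`. -/
def IsSaturated {I : Type*} (φ : W →ₗ[k] I → k) (J : Set I) : Prop :=
  ∀ m (r : ℝ), 0 < r → (∀ i ∉ J, ‖φ m i‖ ≤ r) → ∃ n ∈ coordinateSubmodule φ J, ‖m - n‖ ≤ r

namespace IsCoordinate

variable {N : Submodule k W} {I : Type*} {φ : W →ₗ[k] I → k}

theorem mem_topologicalClosure (h : IsCoordinate N φ) {m : W} (hm : φ m = 0) :
    m ∈ N.topologicalClosure :=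
  mem_topologicalClosure_of_forall_norm_sub_le fun r hr => by
    obtain ⟨n, hn, hmn⟩ := h.approx m r hr fun i => by simp [hm, hr.le]
    exact ⟨n, N.le_topologicalClosure hn, hmn⟩

theorem isClosed_coordinateSubmodule (h : IsCoordinate N φ) (J : Set I) :
    IsClosed (coordinateSubmodule φ J : Set W) := by
  refine isClosed_of_closure_subset fun m hm i hi => ?_
  refine norm_eq_zero.1 (le_antisymm (le_of_forall_pos_le_add fun ε hε => ?_) (norm_nonneg _))
  obtain ⟨n, hn, hmn⟩ := Metric.mem_closure_iff.1 hm ε hε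
  have h1 := h.norm_le (m - n) i
  rw [map_sub, Pi.sub_apply, hn i hi, sub_zero] at h1
  rw [dist_eq_norm] at hmn
  linarith

/-- Saturation of `J` is exactly the `approx` condition for the quotient by the vectors supported on
`J`. -/
theorem restrict (h : IsCoordinate N φ) {J : Set I} (hJ : IsSaturated φ J) :
    IsCoordinate (coordinateSubmodule φ J)
      ((LinearMap.funLeft k k (Subtype.val : (Jᶜ : Set I) → I)).comp φ) where
  tendsto m := (h.tendsto m).comp Subtype.val_injective.tendsto_cofinite
  norm_le m i := h.norm_le m i
  ker _ hn := funext fun i => hn i i.2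
  approx m r hr hm := hJ m r hr fun i hi => hm ⟨i, hi⟩

variable [IsUltrametricDist k] [IsUltrametricDist W]

/-- Gaussian elimination of a single vector. -/
theorem sup_span_singleton (h : IsCoordinate N φ) (d : W) :
    (∃ φ' : W →ₗ[k] I → k, IsCoordinate (N ⊔ Submodule.span k {d}) φ') ∧
      FreeOver N (N ⊔ Submodule.span k {d}) := by
  by_cases hd : φ d = 0
  · refine ⟨⟨φ, h.tendsto, h.norm_le, fun x hx => ?_, fun m r hr hm => ?_⟩, ∅, by simp,
      OrthonormalOver.empty, ?_⟩
    · obtain ⟨n, hn, y, hy, rfl⟩ := Submodule.mem_sup.1 hx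
      obtain ⟨c, rfl⟩ := Submodule.mem_span_singleton.1 hy
      simp [h.ker n hn, hd]
    · obtain ⟨n, hn, hmn⟩ := h.approx m r hr hm
      exact ⟨n, Submodule.mem_sup_left hn, hmn⟩
    · rw [Submodule.span_empty, sup_bot_eq]
      refine sup_le N.le_topologicalClosure ?_
      rw [Submodule.span_singleton_le_iff_mem]
      exact h.mem_topologicalClosure hd
  -- The pivot is a coordinate of maximal norm. Correcting `d` by an element of `N` and rescaling
  -- gives `e` of norm at most one with pivot coordinate one.
  · obtain ⟨i, -, hi, hmax⟩ := exists_max_norm (h.tendsto d) (T := Set.univ)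
      (by simpa using Function.ne_iff.1 hd)
    set c := φ d i with hc
    obtain ⟨n, hn, hdn⟩ := h.approx d ‖c‖ (norm_pos_iff.2 hi) fun j => hmax j trivial
    set e := c⁻¹ • (d - n) with he
    have hφe : φ e = c⁻¹ • φ d := by rw [he, map_smul, map_sub, h.ker n hn, sub_zero]
    have hei : φ e i = 1 := by
      rw [hφe, Pi.smul_apply, smul_eq_mul, ← hc, inv_mul_cancel₀ hi]
    have hen : ‖e‖ ≤ 1 := by
      rw [he, norm_smul, norm_inv]
      calc ‖c‖⁻¹ * ‖d - n‖ ≤ ‖c‖⁻¹ * ‖c‖ := by gcongr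
        _ = 1 := inv_mul_cancel₀ (norm_ne_zero_iff.2 hi)
    have hspan : N ⊔ Submodule.span k {d} = N ⊔ Submodule.span k {e} := by
      refine le_antisymm (sup_le le_sup_left ?_) (sup_le le_sup_left ?_) <;>
        rw [Submodule.span_singleton_le_iff_mem]
      · have : d = n + c • e := by rw [he, smul_inv_smul₀ hi]; abel
        rw [this]
        exact Submodule.add_mem_sup hn
          (Submodule.smul_mem _ _ (Submodule.mem_span_singleton_self e))
      · refine Submodule.smul_mem _ _ (Submodule.sub_mem _ ?_ (Submodule.mem_sup_left hn))
        exact Submodule.mem_sup_right (Submodule.mem_span_singleton_self d)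
    rw [hspan]
    constructor
    · refine ⟨φ - ((LinearMap.proj i).comp φ).smulRight (φ e), ?_, ?_, ?_, ?_⟩
      · intro m
        have := (h.tendsto m).sub ((h.tendsto e).const_smul (φ m i))
        rw [smul_zero, sub_zero] at this
        exact this
      · intro m j
        have h1 : ‖φ m i • φ e j‖ ≤ ‖m‖ := by
          rw [norm_smul]
          calc ‖φ m i‖ * ‖φ e j‖ ≤ ‖m‖ * 1 :=
                mul_le_mul (h.norm_le m i) ((h.norm_le e j).trans hen) (norm_nonneg _)
                  (norm_nonneg _)
            _ = ‖m‖ := mul_one _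
        exact (norm_sub_le_max' _ _).trans (max_le (h.norm_le m j) h1)
      · intro x hx
        obtain ⟨n', hn', y, hy, rfl⟩ := Submodule.mem_sup.1 hx
        obtain ⟨a, rfl⟩ := Submodule.mem_span_singleton.1 hy
        have h1 : φ (n' + a • e) = a • φ e := by
          rw [map_add, map_smul, h.ker n' hn', zero_add]
        change φ (n' + a • e) - (φ (n' + a • e) i) • φ e = 0
        rw [h1, Pi.smul_apply, hei, smul_eq_mul, mul_one, sub_self]
      · intro m r hr hm
        obtain ⟨n', hn', hmn⟩ := h.approx (m - φ m i • e) r hr fun j => by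
          rw [map_sub, map_smul]
          exact hm j
        refine ⟨φ m i • e + n', ?_, by rwa [← sub_sub]⟩
        exact Submodule.add_mem _ (Submodule.mem_sup_right
          (Submodule.smul_mem _ _ (Submodule.mem_span_singleton_self e)))
          (Submodule.mem_sup_left hn')
    · refine ⟨{e}, ?_, ⟨by simpa using hen, fun n hn b hb x => ?_⟩,
        Submodule.le_topologicalClosure _⟩
      · simpa using Submodule.mem_sup_right (Submodule.mem_span_singleton_self e)
      · obtain ⟨a, rfl⟩ : ∃ a, b = Finsupp.single e a := by
          refine ⟨b e, ?_⟩
          rw [← Finsupp.support_subset_singleton]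
          intro y hy
          simpa using hb hy
        have h1 := h.norm_le (n + a • e) i
        simp only [map_add, map_smul, Pi.add_apply, Pi.smul_apply, h.ker n hn, hei,
          Pi.zero_apply, zero_add, smul_eq_mul, mul_one] at h1
        rw [Finsupp.linearCombination_single, id]
        refine le_trans ?_ h1
        classical
        rw [Finsupp.single_apply]
        split_ifs <;> simp

theorem freeOver_union_range (h : IsCoordinate N φ) (d : ℕ → W) :
    FreeOver N.topologicalClosure (closedSpan k (N ∪ Set.range d)) := by
  have key : ∀ n, ∃ φ' : W →ₗ[k] I → k,
      IsCoordinate (N ⊔ Submodule.span k (⋃ j < n, {d j})) φ' := by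
    intro n
    induction n with
    | zero => exact ⟨φ, by simpa using h⟩
    | succ n ih =>
      obtain ⟨φ', h'⟩ := ih
      have := (h'.sup_span_singleton (d n)).1
      rwa [sup_assoc, ← Submodule.span_union, ← Set.biUnion_lt_succ (u := fun j => {d j})] at this
  have hchain := FreeOver.chain (k := k) (N : Set W) (fun n => {d n}) fun n => by
    obtain ⟨φ', h'⟩ := key n
    have := (h'.sup_span_singleton (d n)).2.topologicalClosure
    rw [sup_assoc, ← Submodule.span_union, ← Set.biUnion_lt_succ (u := fun j => {d j})] at this
    rw [closedSpan_union_eq, closedSpan_union_eq]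
    simpa only [Nat.lt_succ_iff] using this
  rw [closedSpan, Submodule.span_eq] at hchain
  simpa using hchain

omit [IsUltrametricDist W] in
-- The largest norm attained outside `J ∪ F` is one of countably many values `ρ`. For each `ρ`, the
-- possible values on the finite set `F` form a separable subset of `k^F`; lifts of a countable
-- dense subset, themselves bounded by `ρ` outside `J ∪ F`, make up `S`.
theorem exists_countable_approx [TopologicalSpace.SeparableSpace k] (h : IsCoordinate N φ)
    (J : Set I) (F : Finset I) :
    ∃ S : Set W, S.Countable ∧ ∀ m (r : ℝ), 0 < r → (∀ j ∉ J, j ∉ F → ‖φ m j‖ ≤ r) →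
      ∃ s ∈ S, ∀ j ∉ J, ‖φ (m - s) j‖ ≤ r := by
  classical
  let g : W → F → k := fun m j => φ m j
  have hY : ∀ ρ : Set.range (norm : k → ℝ), ∃ S : Set W, S.Countable ∧
      (∀ s ∈ S, ∀ j ∉ J, j ∉ F → ‖φ s j‖ ≤ ρ) ∧
      ∀ m, (∀ j ∉ J, j ∉ F → ‖φ m j‖ ≤ ρ) → ∀ r : ℝ, 0 < r →
        ∃ s ∈ S, ∀ j ∈ F, ‖φ (m - s) j‖ ≤ r := by
    intro ρ
    have hsep : TopologicalSpace.IsSeparable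
        (g '' {m | ∀ j ∉ J, j ∉ F → ‖φ m j‖ ≤ ρ}) := .of_separableSpace _
    obtain ⟨t, hts, htc, ht⟩ := hsep.exists_countable_dense_subset
    choose f hf hgf using hts
    have := htc.to_subtype
    refine ⟨Set.range fun y : t => f y.2, Set.countable_range _, ?_, fun m hm r hr => ?_⟩
    · rintro _ ⟨y, rfl⟩
      exact hf y.2
    · obtain ⟨y, hy, hmy⟩ := Metric.mem_closure_iff.1 (ht ⟨m, hm, rfl⟩) r hr
      refine ⟨f hy, ⟨⟨y, hy⟩, rfl⟩, fun j hj => ?_⟩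
      have h1 := (dist_le_pi_dist (g m) y ⟨j, hj⟩).trans hmy.le
      rw [← hgf hy, dist_eq_norm] at h1
      rwa [map_sub]
  choose S hSc hSb hSd using hY
  have hcount : (Set.range (norm : k → ℝ)).Countable := countable_range_norm
  have := hcount.to_subtype
  refine ⟨⋃ ρ, S ρ, Set.countable_iUnion hSc, fun m r hr hm => ?_⟩
  obtain ⟨c, hcr, hc⟩ : ∃ c : k, ‖c‖ ≤ r ∧ ∀ j ∉ J, j ∉ F → ‖φ m j‖ ≤ ‖c‖ := by
    by_cases hne : ∃ i ∈ {j | j ∉ J ∧ j ∉ F}, φ m i ≠ 0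
    · obtain ⟨i, hi, -, hmax⟩ := exists_max_norm (h.tendsto m) hne
      exact ⟨φ m i, hm i hi.1 hi.2, fun j hj hjF => hmax j ⟨hj, hjF⟩⟩
    · push Not at hne
      exact ⟨0, by simpa using hr.le, fun j hj hjF => by simp [hne j ⟨hj, hjF⟩]⟩
  obtain ⟨s, hs, hsr⟩ := hSd ⟨‖c‖, c, rfl⟩ m hc r hr
  refine ⟨s, Set.mem_iUnion.2 ⟨_, hs⟩, fun j hj => ?_⟩
  by_cases hjF : j ∈ F
  · exact hsr j hjF
  · rw [map_sub, Pi.sub_apply]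
    exact (norm_sub_le_max' _ _).trans
      (max_le ((hc j hj hjF).trans hcr) ((hSb _ s hs j hj hjF).trans hcr))

/-- Adjoin to `J` a countable `C` containing the supports of the approximants attached to its finite
subsets. The new vectors are then generated over the old ones by countably many, so elimination
applies. -/
theorem exists_saturated_extension [TopologicalSpace.SeparableSpace k] (h : IsCoordinate N φ)
    {J : Set I} (hJ : IsSaturated φ J) (i : I) :
    ∃ J', J ⊆ J' ∧ i ∈ J' ∧ IsSaturated φ J' ∧
      FreeOver (coordinateSubmodule φ J) (coordinateSubmodule φ J') := by
  choose S hSc hS using h.exists_countable_approx J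
  obtain ⟨C, hC, hiC, hCS⟩ := exists_countable_closed (fun F => ⋃ s ∈ S F, {j | φ s j ≠ 0})
    (fun F => (hSc F).biUnion fun s _ => countable_support (h.tendsto s)) i
  have hSJ : ∀ F : Finset I, (F : Set I) ⊆ C → ∀ s ∈ S F, s ∈ coordinateSubmodule φ (J ∪ C) := by
    intro F hF s hs j hj
    by_contra hne
    exact hj (Or.inr (hCS F hF (Set.mem_biUnion hs hne)))
  have key : ∀ m (r : ℝ), 0 < r → (∀ j ∉ J ∪ C, ‖φ m j‖ ≤ r) →
      ∃ F : Finset I, (F : Set I) ⊆ C ∧ ∃ s ∈ S F, ∃ n ∈ coordinateSubmodule φ J,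
        ‖m - (n + s)‖ ≤ r := by
    intro m r hr hm
    -- The finite set fed to the approximation consists of the indices in `C` where `m` exceeds `r`.
    have hfin := (finite_setOf_lt_norm (h.tendsto m) hr).inter_of_left C
    obtain ⟨s, hs, hsr⟩ := hS hfin.toFinset m r hr fun j hj hjF => by
      by_contra hlt
      by_cases hjC : j ∈ C
      · exact hjF (by simpa using ⟨not_le.1 hlt, hjC⟩)
      · exact hlt (hm j (by simp [hj, hjC]))
    obtain ⟨n, hn, hmn⟩ := hJ (m - s) r hr hsr
    exact ⟨hfin.toFinset, by simp, s, hs, n, hn, by rwa [add_comm, ← sub_sub]⟩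
  refine ⟨J ∪ C, Set.subset_union_left, Or.inr hiC, fun m r hr hm => ?_, ?_⟩
  · obtain ⟨F, hF, s, hs, n, hn, hmn⟩ := key m r hr hm
    exact ⟨n + s, add_mem (coordinateSubmodule_mono φ Set.subset_union_left hn)
      (hSJ F hF s hs), hmn⟩
  · set D : Set W := ⋃ F ∈ {F : Finset I | (F : Set I) ⊆ C}, S F with hD
    have hDc : D.Countable := by
      refine Set.Countable.biUnion ?_ fun F _ => hSc F
      have := (Set.countable_ofPred_finite_subset hC).preimage (Finset.coe_injective (α := I))
      exact this.mono fun F hF => show (F : Set I).Finite ∧ (F : Set I) ⊆ C from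
        ⟨F.finite_toSet, hF⟩
    have hDne : D.Nonempty := by
      obtain ⟨F, hF, s, hs, -⟩ := key 0 1 one_pos (by simp)
      exact ⟨s, Set.mem_biUnion (show F ∈ {F : Finset I | (F : Set I) ⊆ C} from hF) hs⟩
    obtain ⟨d, hd⟩ := hDc.exists_eq_range hDne
    have hfree := (h.restrict hJ).freeOver_union_range d
    rw [← hd] at hfree
    have h1 : (coordinateSubmodule φ J).topologicalClosure = coordinateSubmodule φ J :=
      (h.isClosed_coordinateSubmodule J).submodule_topologicalClosure_eq
    have h2 : closedSpan k (coordinateSubmodule φ J ∪ D) = coordinateSubmodule φ (J ∪ C) := by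
      refine le_antisymm ?_ fun m hm => ?_
      · refine Submodule.topologicalClosure_minimal _ (Submodule.span_le.2 ?_)
          (h.isClosed_coordinateSubmodule _)
        exact Set.union_subset (coordinateSubmodule_mono φ Set.subset_union_left)
          (Set.iUnion₂_subset fun F hF => hSJ F hF)
      · refine mem_topologicalClosure_of_forall_norm_sub_le fun r hr => ?_
        obtain ⟨F, hF, s, hs, n, hn, hmn⟩ := key m r hr fun j hj => by simp [hm j hj, hr.le]
        refine ⟨n + s, Submodule.le_topologicalClosure _ (add_mem ?_ ?_), hmn⟩
        · exact Submodule.subset_span (Or.inl hn)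
        · exact Submodule.subset_span (Or.inr (Set.mem_biUnion
            (show F ∈ {F : Finset I | (F : Set I) ⊆ C} from hF) hs))
    rwa [h1, h2] at hfree

/-- A normed space with enough null families of coordinates is free (Gruson). -/
theorem freeOver_top [TopologicalSpace.SeparableSpace k] (h : IsCoordinate N φ) :
    FreeOver N ⊤ := by
  let P : Set (Set I × Set W) := {p | IsSaturated φ p.1 ∧ p.2 ⊆ coordinateSubmodule φ p.1 ∧
    OrthonormalOver N p.2 ∧
    coordinateSubmodule φ p.1 ≤ (N ⊔ Submodule.span k p.2).topologicalClosure}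
  have hbot : ((∅, ∅) : Set I × Set W) ∈ P := by
    refine ⟨fun m r hr hm => ?_, by simp, OrthonormalOver.empty, fun m hm => ?_⟩
    · obtain ⟨n, hn, hmn⟩ := h.approx m r hr fun i => hm i (by simp)
      exact ⟨n, fun i _ => by rw [h.ker n hn]; rfl, hmn⟩
    · have : φ m = 0 := funext fun i => hm i (by simp)
      simpa using h.mem_topologicalClosure this
  obtain ⟨⟨J, E⟩, -, hmax⟩ := zorn_le_nonempty₀ P (fun c hcP hc p₀ hp₀ => by
    have hne : Nonempty c := ⟨⟨p₀, hp₀⟩⟩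
    have hdir : Directed (· ≤ ·) (Subtype.val : c → Set I × Set W) := hc.directed
    have hd1 : Directed (· ⊆ ·) fun p : c => p.1.1 := fun a b =>
      (hdir a b).imp fun _ h => ⟨h.1.1, h.2.1⟩
    have hd2 : Directed (· ⊆ ·) fun p : c => p.1.2 := fun a b =>
      (hdir a b).imp fun _ h => ⟨h.1.2, h.2.2⟩
    -- Saturation survives unions of chains: the finitely many coordinates exceeding `r` all lie in
    -- one member.
    have key : ∀ m (r : ℝ), 0 < r → (∀ i ∉ ⋃ p : c, p.1.1, ‖φ m i‖ ≤ r) →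
        ∃ p : c, ∃ n ∈ coordinateSubmodule φ p.1.1, ‖m - n‖ ≤ r := by
      intro m r hr hm
      have hfin := finite_setOf_lt_norm (h.tendsto m) hr
      have hsub : (hfin.toFinset : Set I) ⊆ ⋃ p : c, p.1.1 := by
        intro i hi
        by_contra hi'
        exact absurd (hm i hi') (not_le.2 (by simpa using hi))
      obtain ⟨p, hp⟩ := hd1.exists_mem_subset_of_finset_subset_biUnion hsub
      refine ⟨p, (hcP p.2).1 m r hr fun i hi => ?_⟩
      by_contra hlt
      exact hi (hp (by simpa using hlt))
    have hle : ∀ p : c, coordinateSubmodule φ p.1.1 ≤ coordinateSubmodule φ (⋃ p : c, p.1.1) :=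
      fun p => coordinateSubmodule_mono φ (Set.subset_iUnion (fun p : c => p.1.1) p)
    refine ⟨(⋃ p : c, p.1.1, ⋃ p : c, p.1.2), ⟨fun m r hr hm => ?_, ?_, ?_, fun m hm => ?_⟩,
      fun p hp => ⟨Set.subset_iUnion (fun p : c => p.1.1) ⟨p, hp⟩,
        Set.subset_iUnion (fun p : c => p.1.2) ⟨p, hp⟩⟩⟩
    · obtain ⟨p, n, hn, hmn⟩ := key m r hr hm
      exact ⟨n, hle p hn, hmn⟩
    · exact Set.iUnion_subset fun p => (hcP p.2).2.1.trans (hle p)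
    · exact OrthonormalOver.iUnion hd2 fun p => (hcP p.2).2.2.1
    · refine mem_topologicalClosure_of_forall_norm_sub_le fun r hr => ?_
      obtain ⟨p, n, hn, hmn⟩ := key m r hr fun i hi => by simp [hm i hi, hr.le]
      refine ⟨n, ?_, hmn⟩
      exact Submodule.topologicalClosure_mono (sup_le_sup_left (Submodule.span_mono
        (Set.subset_iUnion (fun p : c => p.1.2) p)) N) ((hcP p.2).2.2.2 hn)) _ hbot
  obtain ⟨hJ, hEJ, hE, hJE⟩ := hmax.prop
  have huniv : J = Set.univ := by
    refine Set.eq_univ_of_forall fun i => ?_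
    obtain ⟨J', hJJ', hi, hJ', E', hE'J', hE', hJ'E'⟩ := h.exists_saturated_extension hJ i
    have hNJ : N ≤ coordinateSubmodule φ J := fun n hn i _ => by rw [h.ker n hn]; rfl
    have hmem : (J', E ∪ E') ∈ P := by
      refine ⟨hJ', Set.union_subset (hEJ.trans (coordinateSubmodule_mono φ hJJ')) hE'J',
        hE.union hEJ hNJ hE', hJ'E'.trans ?_⟩
      refine Submodule.topologicalClosure_minimal _ (sup_le (hJE.trans ?_) ?_)
        (Submodule.isClosed_topologicalClosure _)
      · exact Submodule.topologicalClosure_mono (sup_le_sup_left (Submodule.span_mono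
          Set.subset_union_left) N)
      · exact ((Submodule.span_mono Set.subset_union_right).trans le_sup_right).trans
          (Submodule.le_topologicalClosure _)
    exact (hmax.le_of_ge hmem ⟨hJJ', Set.subset_union_left⟩).1 hi
  refine ⟨E, fun _ _ => trivial, hE, le_trans ?_ hJE⟩
  intro m _ i hi
  exact absurd (huniv ▸ Set.mem_univ i) hi

end IsCoordinate
end Coordinates

/-! ### Coordinates from orthonormal families; heredity of freeness -/

section Bases

variable {k : Type v} [NormedField k] {V : Type u} [NormedAddCommGroup V] [NormedSpace k V]

/-- `c` is the coordinate family of `m` along `E` modulo `N`. -/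
def IsCoordinateFamily (N : Submodule k V) (E : Set V) (m : V) (c : V → k) : Prop :=
  ∀ r : ℝ, 0 < r → ∃ n ∈ N, ∃ b ∈ Finsupp.supported k k E,
    ‖m - (n + Finsupp.linearCombination k (id : V → V) b)‖ ≤ r ∧ ∀ e, ‖b e - c e‖ ≤ r

variable [IsUltrametricDist V] {N : Submodule k V} {E : Set V}

theorem OrthonormalOver.norm_sub_le (ho : OrthonormalOver N E) {m n n' : V} (hn : n ∈ N)
    (hn' : n' ∈ N) {b b' : V →₀ k} (hb : b ∈ Finsupp.supported k k E)
    (hb' : b' ∈ Finsupp.supported k k E) {r : ℝ}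
    (h : ‖m - (n + Finsupp.linearCombination k (id : V → V) b)‖ ≤ r)
    (h' : ‖m - (n' + Finsupp.linearCombination k (id : V → V) b')‖ ≤ r) (e : V) :
    ‖b e - b' e‖ ≤ r := by
  refine (ho.2 (n - n') (N.sub_mem hn hn') (b - b') (Submodule.sub_mem _ hb hb') e).trans ?_
  rw [map_sub]
  set x := Finsupp.linearCombination k (id : V → V) b
  set x' := Finsupp.linearCombination k (id : V → V) b'
  have : n - n' + (x - x') = (m - (n' + x')) - (m - (n + x)) := by abel
  rw [this]
  exact (norm_sub_le_max' _ _).trans (max_le h' h)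

theorem OrthonormalOver.exists_isCoordinateFamily [CompleteSpace k] (ho : OrthonormalOver N E)
    {m : V} (hm : m ∈ (N ⊔ Submodule.span k E).topologicalClosure) :
    ∃ c, IsCoordinateFamily N E m c := by
  have h : ∀ j : ℕ, ∃ n ∈ N, ∃ b ∈ Finsupp.supported k k E,
      ‖m - (n + Finsupp.linearCombination k (id : V → V) b)‖ ≤ 1 / ((j : ℝ) + 1) := by
    intro j
    obtain ⟨y, hy, hmy⟩ := Metric.mem_closure_iff.1 hm _ (Nat.one_div_pos_of_nat (n := j))
    obtain ⟨n, hn, x, hx, rfl⟩ := Submodule.mem_sup.1 hy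
    obtain ⟨b, hb, rfl⟩ := (Finsupp.mem_span_image_iff_linearCombination k
      (v := (id : V → V)) (s := E)).1 (by simpa using hx)
    exact ⟨n, hn, b, hb, by rw [← dist_eq_norm]; exact hmy.le⟩
  choose n hn b hb hnb using h
  have hle : ∀ i j, i ≤ j → ∀ e, ‖b i e - b j e‖ ≤ 1 / ((i : ℝ) + 1) := fun i j hij e =>
    ho.norm_sub_le (hn i) (hn j) (hb i) (hb j) (hnb i)
      ((hnb j).trans (Nat.one_div_le_one_div hij)) e
  have hlim : ∀ e, ∃ c, Filter.Tendsto (fun j => b j e) Filter.atTop (𝓝 c) := fun e =>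
    cauchySeq_tendsto_of_complete (cauchySeq_of_le_tendsto_0' _
      (fun i j hij => by rw [dist_eq_norm]; exact hle i j hij e)
      tendsto_one_div_add_atTop_nhds_zero_nat)
  choose c hc using hlim
  refine ⟨c, fun r hr => ?_⟩
  obtain ⟨j, hj⟩ := exists_nat_one_div_lt hr
  refine ⟨n j, hn j, b j, hb j, (hnb j).trans hj.le, fun e => ?_⟩
  refine le_of_tendsto ((hc e).const_sub (b j e)).norm ?_
  filter_upwards [Filter.eventually_ge_atTop j] with i hi
  exact (hle j i hi e).trans hj.le

namespace IsCoordinateFamily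

variable {m m' : V} {c c' : V → k}

omit [IsUltrametricDist V] in
theorem tendsto (h : IsCoordinateFamily N E m c) :
    Filter.Tendsto c Filter.cofinite (𝓝 0) := by
  rw [Metric.tendsto_nhds]
  intro ε hε
  obtain ⟨n, -, b, -, -, hbc⟩ := h (ε / 2) (by positivity)
  rw [Filter.eventually_cofinite]
  refine b.support.finite_toSet.subset fun e he => ?_
  by_contra hb
  have h0 : b e = 0 := by simpa using hb
  have h1 := hbc e
  rw [h0, zero_sub, norm_neg] at h1
  rw [Set.mem_ofPred_eq, dist_zero_right] at he
  linarith

variable [IsUltrametricDist k]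

theorem unique (ho : OrthonormalOver N E) (h : IsCoordinateFamily N E m c)
    (h' : IsCoordinateFamily N E m c') : c = c' := by
  ext e
  rw [← sub_eq_zero]
  refine norm_eq_zero.1 (le_antisymm (le_of_forall_pos_le_add fun ε hε => ?_) (norm_nonneg _))
  obtain ⟨n, hn, b, hb, hnb, hbc⟩ := h ε hε
  obtain ⟨n', hn', b', hb', hnb', hbc'⟩ := h' ε hε
  have h1 := ho.norm_sub_le hn hn' hb hb' hnb hnb' e
  have : c e - c' e = (b e - b' e) - (b e - c e) + (b' e - c' e) := by abel
  rw [this, zero_add]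
  exact (IsUltrametricDist.norm_add_le_max _ _).trans
    (max_le ((norm_sub_le_max' _ _).trans (max_le h1 (hbc e))) (hbc' e))

theorem add (h : IsCoordinateFamily N E m c) (h' : IsCoordinateFamily N E m' c') :
    IsCoordinateFamily N E (m + m') (c + c') := by
  intro r hr
  obtain ⟨n, hn, b, hb, hnb, hbc⟩ := h r hr
  obtain ⟨n', hn', b', hb', hnb', hbc'⟩ := h' r hr
  refine ⟨n + n', N.add_mem hn hn', b + b', Submodule.add_mem _ hb hb', ?_, fun e => ?_⟩
  · rw [map_add, add_add_add_comm, add_sub_add_comm]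
    exact (IsUltrametricDist.norm_add_le_max _ _).trans (max_le hnb hnb')
  · rw [Finsupp.add_apply, Pi.add_apply, add_sub_add_comm]
    exact (IsUltrametricDist.norm_add_le_max _ _).trans (max_le (hbc e) (hbc' e))

omit [IsUltrametricDist V] [IsUltrametricDist k] in
theorem smul (a : k) (h : IsCoordinateFamily N E m c) :
    IsCoordinateFamily N E (a • m) (a • c) := by
  intro r hr
  have ha : 0 < ‖a‖ + 1 := by positivity
  obtain ⟨n, hn, b, hb, hnb, hbc⟩ := h (r / (‖a‖ + 1)) (by positivity)
  have key : ∀ x : ℝ, 0 ≤ x → x ≤ r / (‖a‖ + 1) → ‖a‖ * x ≤ r := fun x hx hxr =>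
    calc ‖a‖ * x ≤ (‖a‖ + 1) * (r / (‖a‖ + 1)) := by gcongr; linarith
      _ = r := by field_simp
  refine ⟨a • n, N.smul_mem a hn, a • b, Submodule.smul_mem _ a hb, ?_, fun e => ?_⟩
  · rw [map_smul, ← smul_add, ← smul_sub, norm_smul]
    exact key _ (norm_nonneg _) hnb
  · rw [Finsupp.smul_apply, Pi.smul_apply, ← smul_sub, norm_smul]
    exact key _ (norm_nonneg _) (hbc e)

omit [IsUltrametricDist V] [IsUltrametricDist k] in
theorem of_mem (hm : m ∈ N) : IsCoordinateFamily N E m 0 := fun r hr =>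
  ⟨m, hm, 0, Submodule.zero_mem _, by simp [hr.le], by simp [hr.le]⟩

theorem norm_le (ho : OrthonormalOver N E) (h : IsCoordinateFamily N E m c) (e : V) :
    ‖c e‖ ≤ ‖m‖ := by
  by_cases hm : m = 0
  · rw [h.unique ho (hm ▸ of_mem N.zero_mem : IsCoordinateFamily N E m 0)]
    simp
  · obtain ⟨n, hn, b, hb, hnb, hbc⟩ := h ‖m‖ (norm_pos_iff.2 hm)
    set x := n + Finsupp.linearCombination k (id : V → V) b with hx
    have h1 : ‖x‖ ≤ ‖m‖ := by
      have : x = m - (m - x) := by abel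
      rw [this]
      exact (norm_sub_le_max' _ _).trans (max_le le_rfl hnb)
    have : c e = b e - (b e - c e) := by abel
    rw [this]
    exact (norm_sub_le_max' _ _).trans (max_le ((ho.2 n hn b hb e).trans h1) (hbc e))

theorem approx (ho : OrthonormalOver N E) (h : IsCoordinateFamily N E m c) {r : ℝ} (hr : 0 < r)
    (hc : ∀ e, ‖c e‖ ≤ r) : ∃ n ∈ N, ‖m - n‖ ≤ r := by
  obtain ⟨n, hn, b, hb, hnb, hbc⟩ := h r hr
  refine ⟨n, hn, ?_⟩
  have hb' : ‖Finsupp.linearCombination k (id : V → V) b‖ ≤ r := by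
    refine OrthonormalOver.norm_linearCombination_le ho.1 hb hr.le fun e => ?_
    have : b e = (b e - c e) + c e := by abel
    rw [this]
    exact (IsUltrametricDist.norm_add_le_max _ _).trans (max_le (hbc e) (hc e))
  have : m - n = (m - (n + Finsupp.linearCombination k (id : V → V) b)) +
      Finsupp.linearCombination k (id : V → V) b := by abel
  rw [this]
  exact (IsUltrametricDist.norm_add_le_max _ _).trans (max_le hnb hb')

end IsCoordinateFamily

variable [IsUltrametricDist k] [CompleteSpace k]

/-- `E` need not lie in `P`: coordinates along `E` still control the distance to `N`, and `N ≤ P`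
keeps the approximants in `P`. This is why freeness descends to `P`. -/
theorem OrthonormalOver.exists_isCoordinate {P : Submodule k V} (ho : OrthonormalOver N E)
    (hNP : N ≤ P) (hP : P ≤ (N ⊔ Submodule.span k E).topologicalClosure) :
    ∃ φ : P →ₗ[k] V → k, IsCoordinate (N.comap P.subtype) φ ∧
      ∀ m : P, IsCoordinateFamily N E m (φ m) := by
  choose c hc using fun m : P => ho.exists_isCoordinateFamily (hP m.2)
  let φ : P →ₗ[k] V → k :=
    { toFun := c
      map_add' := fun m m' => (hc (m + m')).unique ho ((hc m).add (hc m'))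
      map_smul' := fun a m => (hc (a • m)).unique ho ((hc m).smul a) }
  refine ⟨φ, ⟨fun m => (hc m).tendsto, fun m => (hc m).norm_le ho, fun n hn => ?_,
    fun m r hr hm => ?_⟩, hc⟩
  · exact (hc n).unique ho (IsCoordinateFamily.of_mem hn)
  · obtain ⟨n, hn, hmn⟩ := (hc m).approx ho hr hm
    exact ⟨⟨n, hNP hn⟩, hn, hmn⟩

/-- Freeness over `N` is inherited by intermediate subspaces. -/
theorem FreeOver.of_le [TopologicalSpace.SeparableSpace k] {N M P : Submodule k V}
    (h : FreeOver N M) (hNP : N ≤ P) (hPM : P ≤ M) : FreeOver N P := by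
  obtain ⟨E, -, ho, hM⟩ := h
  obtain ⟨φ, hφ, -⟩ := ho.exists_isCoordinate hNP (hPM.trans hM)
  have h1 := hφ.freeOver_top.map P.subtypeₗᵢ
  have h2 : (N.comap P.subtype).map P.subtypeₗᵢ.toLinearMap = N := by
    refine (Submodule.map_comap_subtype P N).trans (inf_eq_right.2 hNP)
  have h3 : (⊤ : Submodule k P).map P.subtypeₗᵢ.toLinearMap = P :=
    Submodule.map_subtype_top P
  rwa [h2, h3] at h1

end Bases

/-! ### Relative freeness over zero versus Schauder bases -/

section Schauder

variable {k : Type v} [NormedField k] {V : Type u} [NormedAddCommGroup V] [NormedSpace k V]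

theorem bddAbove_range_norm {I : Type*} {c : I → k}
    (hc : Filter.Tendsto c Filter.cofinite (𝓝 0)) : BddAbove (Set.range fun i => ‖c i‖) := by
  have hfin := finite_setOf_lt_norm hc one_pos
  obtain ⟨B, hB⟩ := (hfin.image fun i => ‖c i‖).bddAbove
  refine ⟨max 1 B, ?_⟩
  rintro _ ⟨i, rfl⟩
  by_cases hi : 1 < ‖c i‖
  · exact le_max_of_le_right (hB ⟨i, hi, rfl⟩)
  · exact le_max_of_le_left (not_lt.1 hi)

theorem hasSum_linearCombination {E : Set V} {b : V →₀ k} (hb : b ∈ Finsupp.supported k k E) :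
    HasSum (fun e : E => b e • (e : V)) (Finsupp.linearCombination k (id : V → V) b) := by
  have h1 : HasSum (fun e : V => b e • e) (Finsupp.linearCombination k (id : V → V) b) := by
    rw [Finsupp.linearCombination_apply, Finsupp.sum]
    exact hasSum_sum_of_ne_finset_zero fun e he => by simp [Finsupp.notMem_support_iff.1 he]
  refine (hasSum_subtype_iff_of_support_subset fun e he => ?_).2 h1
  exact hb (by simpa using fun h0 => he (by simp [h0]))

theorem IsFreeBanach.freeOver (h : IsFreeBanach k V) :
    FreeOver (⊥ : Submodule k V) ⊤ := by
  obtain ⟨E, hE⟩ := h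
  refine ⟨E, fun _ _ => trivial, ⟨fun e he => (hE.norm_eq_one e he).le, fun n hn b hb e => ?_⟩,
    fun v _ => ?_⟩
  · rw [(Submodule.mem_bot k).1 hn, zero_add]
    by_cases he : e ∈ E
    · have hb0 : Filter.Tendsto (fun e : E => b e) Filter.cofinite (𝓝 0) := by
        refine tendsto_nhds_of_eventually_eq ?_
        rw [Filter.eventually_cofinite]
        exact (b.support.finite_toSet.preimage Subtype.val_injective.injOn).subset
          fun e he => by simpa using he
      obtain ⟨s, hs, hsn⟩ := hE.norm_sum _ hb0
      rw [← hs.unique (hasSum_linearCombination hb), hsn]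
      exact le_ciSup (bddAbove_range_norm hb0) (⟨e, he⟩ : E)
    · have : b e = 0 := by
        by_contra hne
        exact he (hb (by simpa using hne))
      simp [this]
  · obtain ⟨c, -, hc⟩ := hE.exists_coeff v
    refine mem_closure_of_tendsto hc (Filter.Eventually.of_forall fun T => ?_)
    exact Submodule.sum_mem _ fun e _ => Submodule.smul_mem _ _
      (Submodule.mem_sup_right (Submodule.subset_span e.2))

variable [IsUltrametricDist k] [CompleteSpace k] [IsUltrametricDist V] [CompleteSpace V]

omit [IsUltrametricDist k] in
theorem FreeOver.isFreeBanach (h : FreeOver (⊥ : Submodule k V) ⊤) : IsFreeBanach k V := by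
  classical
  obtain ⟨E, -, ho, hd⟩ := h
  have hsum : ∀ c : E → k, Filter.Tendsto c Filter.cofinite (𝓝 0) →
      Summable fun e : E => c e • (e : V) := by
    intro c hc
    refine NonarchimedeanAddGroup.summable_of_tendsto_cofinite_zero ?_
    refine squeeze_zero_norm (fun e => ?_) (tendsto_zero_iff_norm_tendsto_zero.1 hc)
    rw [norm_smul]
    exact mul_le_of_le_one_right (norm_nonneg _) (ho.1 e e.2)
  have hle : ∀ (c : E → k) (s : V) (r : ℝ), HasSum (fun e : E => c e • (e : V)) s → 0 ≤ r →
      (∀ e, ‖c e‖ ≤ r) → ‖s‖ ≤ r := by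
    intro c s r hs hr hc
    rw [← hs.tsum_eq]
    refine IsUltrametricDist.norm_tsum_le_of_forall_le_of_nonneg hr fun e => ?_
    rw [norm_smul]
    exact (mul_le_of_le_one_right (norm_nonneg _) (ho.1 e e.2)).trans (hc e)
  refine ⟨E, fun e he => le_antisymm (ho.1 e he) ?_, fun c hc => ?_, fun v => ?_⟩
  · have := ho.2 0 (Submodule.zero_mem _) (Finsupp.single e 1)
      (Finsupp.single_mem_supported k 1 he) e
    simpa using this
  · obtain ⟨s, hs⟩ := hsum c hc
    refine ⟨s, hs, le_antisymm ?_ ?_⟩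
    · exact hle c s _ hs (Real.iSup_nonneg fun e => norm_nonneg _)
        fun e => le_ciSup (bddAbove_range_norm hc) e
    · refine Real.iSup_le (fun e => ?_) (norm_nonneg _)
      refine ge_of_tendsto hs.norm ?_
      filter_upwards [Filter.eventually_ge_atTop {e}] with T hT
      have hb : (∑ x ∈ T, Finsupp.single (x : V) (c x)) ∈ Finsupp.supported k k E :=
        Submodule.sum_mem _ fun x _ => Finsupp.single_mem_supported k _ x.2
      have h1 := ho.2 0 (Submodule.zero_mem _) _ hb e
      rw [zero_add, map_sum, Finsupp.finsetSum_apply] at h1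
      simp only [Finsupp.linearCombination_single, id, Finsupp.single_apply] at h1
      simpa [Subtype.coe_inj, show e ∈ T from hT (Finset.mem_singleton_self e)] using h1
  · obtain ⟨c, hc⟩ := ho.exists_isCoordinateFamily (hd (Submodule.mem_top (x := v)))
    have hc0 : Filter.Tendsto (fun e : E => c e) Filter.cofinite (𝓝 0) :=
      hc.tendsto.comp Subtype.val_injective.tendsto_cofinite
    obtain ⟨s, hs⟩ := hsum _ hc0
    refine ⟨_, hc0, ?_⟩
    suffices hvs : v = s by rwa [hvs]
    rw [← sub_eq_zero]
    refine norm_eq_zero.1 (le_antisymm (le_of_forall_pos_le_add fun ε hε => ?_) (norm_nonneg _))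
    obtain ⟨n, hn, b, hb, hnb, hbc⟩ := hc ε hε
    rw [(Submodule.mem_bot k).1 hn, zero_add] at hnb
    have h1 := (hasSum_linearCombination hb).sub hs
    simp only [← sub_smul] at h1
    have h2 := hle _ _ ε h1 hε.le fun e => hbc e
    rw [zero_add, ← sub_add_sub_cancel v (Finsupp.linearCombination k (id : V → V) b) s]
    exact (IsUltrametricDist.norm_add_le_max _ _).trans (max_le hnb h2)

end Schauder

/-! ### Regular cardinals: an ultraproduct of bases -/

section Ultrafilter

variable {k : Type v} [NormedField k] {V : Type u} [NormedAddCommGroup V] [NormedSpace k V]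

theorem IsFreeBanach.freeOver_of_submodule {P : Submodule k V} (h : IsFreeBanach k P) :
    FreeOver ⊥ P := by
  have h1 := h.freeOver.map P.subtypeₗᵢ
  have h2 : (⊤ : Submodule k P).map P.subtypeₗᵢ.toLinearMap = P := Submodule.map_subtype_top P
  rwa [h2, Submodule.map_bot] at h1

variable [IsUltrametricDist k] [CompleteSpace k] [TopologicalSpace.SeparableSpace k]
  [IsUltrametricDist V]

/-- Closed subspaces of free Banach spaces are free. -/
theorem IsFreeBanach.submodule [CompleteSpace V] (h : IsFreeBanach k V) {P : Submodule k V}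
    (hP : IsClosed (P : Set V)) : IsFreeBanach k P := by
  obtain ⟨E, -, ho, hM⟩ := h.freeOver
  obtain ⟨φ, hφ, -⟩ := ho.exists_isCoordinate (bot_le : ⊥ ≤ P) (le_top.trans hM)
  have h1 := hφ.freeOver_top
  have : CompleteSpace P := hP.completeSpace_coe
  rw [show (⊥ : Submodule k V).comap P.subtype = ⊥ from P.ker_subtype] at h1
  exact h1.isFreeBanach

omit [IsUltrametricDist k] [CompleteSpace k] in
theorem exists_eventually_eq_const {ι : Type*} (U : Ultrafilter ι)
    [CountableInterFilter (U : Filter ι)] (f : ι → k) :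
    ∃ a, ∀ᶠ i in (U : Filter ι), f i = a := by
  have := UniformSpace.secondCountable_of_separable k
  exact Filter.exists_eventuallyEq_const_of_forall_separating (fun s : Set k => IsOpen s)
    fun s _ => U.em fun i => f i ∈ s

/-- If almost every space of a family is free with respect to a countably complete ultrafilter and
every vector belongs to almost every space of the family, then the whole space is free. -/
theorem freeOver_top_of_ultrafilter {ι : Type*} (U : Ultrafilter ι)
    [CountableInterFilter (U : Filter ι)] (P : ι → Submodule k V)
    (hP : ∀ i, FreeOver ⊥ (P i)) (hmem : ∀ v, ∀ᶠ i in (U : Filter ι), v ∈ P i) :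
    FreeOver (⊥ : Submodule k V) ⊤ := by
  classical
  choose E hEP ho hd using hP
  choose ψ hψ _ using fun i => (ho i).exists_isCoordinate bot_le (hd i)
  let coef : ι → V → V → k := fun i v x => if h : v ∈ P i then ψ i ⟨v, h⟩ x else 0
  have hcoef : ∀ i v (h : v ∈ P i) x, coef i v x = ψ i ⟨v, h⟩ x := fun i v h x => dif_pos h
  choose a ha using fun (v : V) (f : ι → V) =>
    exists_eventually_eq_const U fun i => coef i v (f i)
  -- Coordinates are indexed by germs, not functions: functions agreeing almost everywhere give the
  -- same coordinate, and repetitions would destroy decay.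
  choose rep hrep using fun g : (U : Filter ι).Germ V =>
    g.inductionOn (p := fun g => ∃ f : ι → V, (f : (U : Filter ι).Germ V) = g) fun f => ⟨f, rfl⟩
  let φ : V →ₗ[k] (U : Filter ι).Germ V → k :=
    { toFun := fun v g => a v (rep g)
      map_add' := fun v w => funext fun g => by
        obtain ⟨i, h1, h2, h3, hv, hw⟩ := ((ha (v + w) (rep g)).and ((ha v (rep g)).and
          ((ha w (rep g)).and ((hmem v).and (hmem w))))).exists
        rw [Pi.add_apply, ← h1, ← h2, ← h3, hcoef i v hv, hcoef i w hw,
          hcoef i (v + w) (add_mem hv hw), ← Pi.add_apply, ← map_add]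
        rfl
      map_smul' := fun c v => funext fun g => by
        obtain ⟨i, h1, h2, hv⟩ := ((ha (c • v) (rep g)).and ((ha v (rep g)).and (hmem v))).exists
        rw [Pi.smul_apply, ← h1, ← h2, hcoef i v hv, hcoef i (c • v) ((P i).smul_mem c hv),
          RingHom.id_apply, ← Pi.smul_apply, ← map_smul]
        rfl }
  have hφ : ∀ v g, ∀ᶠ i in (U : Filter ι), ∃ h : v ∈ P i, ψ i ⟨v, h⟩ (rep g i) = φ v g := by
    intro v g
    filter_upwards [hmem v, ha v (rep g)] with i hi hi'
    exact ⟨hi, by rw [← hcoef i v hi]; exact hi'⟩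
  refine IsCoordinate.freeOver_top (φ := φ) ⟨fun v => ?_, fun v g => ?_, fun n hn => ?_,
    fun v r hr hv => ⟨0, Submodule.zero_mem _, ?_⟩⟩
  · rw [Metric.tendsto_nhds]
    intro ε hε
    rw [Filter.eventually_cofinite]
    by_contra hinf
    -- Infinitely many large coordinates give a sequence of distinct germs. By countable
    -- completeness, at a single `i` these have pairwise distinct values and retain their
    -- coordinates, contradicting decay in `P i`.
    let g := (show Set.Infinite _ from hinf).natEmbedding
    have hne : ∀ m n, m ≠ n →
        ∀ᶠ i in (U : Filter ι), rep (g m).1 i ≠ rep (g n).1 i := by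
      intro m n hmn
      rcases U.em fun i => rep (g m).1 i = rep (g n).1 i with h | h
      · have h1 : ((rep (g m).1 : ι → V) : (U : Filter ι).Germ V) = (rep (g n).1 : ι → V) :=
          Filter.Germ.coe_eq.2 h
        rw [hrep, hrep] at h1
        exact absurd (g.injective (Subtype.ext h1)) hmn
      · exact h
    have h1 : ∀ᶠ i in (U : Filter ι), ∀ p : ℕ × ℕ, p.1 ≠ p.2 →
        rep (g p.1).1 i ≠ rep (g p.2).1 i :=
      eventually_countable_forall.2 fun p => by
        by_cases hp : p.1 = p.2
        · exact Filter.Eventually.of_forall fun i h => absurd hp h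
        · exact (hne _ _ hp).mono fun i hi _ => hi
    have h2 : ∀ᶠ i in (U : Filter ι), ∀ n : ℕ,
        ∃ h : v ∈ P i, ψ i ⟨v, h⟩ (rep (g n).1 i) = φ v (g n).1 :=
      eventually_countable_forall.2 fun n => hφ v (g n).1
    obtain ⟨i, hi1, hi2⟩ := (h1.and h2).exists
    obtain ⟨hvi, -⟩ := hi2 0
    have hfin := finite_setOf_lt_norm ((hψ i).tendsto ⟨v, hvi⟩) (half_pos hε)
    refine Set.infinite_of_injective_forall_mem (f := fun n => rep (g n).1 i) ?_ ?_ hfin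
    · intro m n hmn
      by_contra hne
      exact hi1 (m, n) hne hmn
    · intro n
      obtain ⟨_, h⟩ := hi2 n
      have h3 : ¬ dist (φ v (g n).1) 0 < ε := (g n).2
      rw [dist_zero_right] at h3
      change ε / 2 < ‖ψ i ⟨v, hvi⟩ (rep (g n).1 i)‖
      rw [h]
      linarith
  · obtain ⟨i, hi, h⟩ := (hφ v g).exists
    rw [← h]
    exact (hψ i).norm_le ⟨v, hi⟩ _
  · rw [(Submodule.mem_bot k).1 hn, map_zero]
  · by_contra hlt
    -- A vector of norm above `r` has a coordinate above `r` in every `P i` containing it; the germ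
    -- of such choices is an index contradicting `hv`.
    have h1 : ∀ i, ∃ x, ∀ h : v ∈ P i, r < ‖ψ i ⟨v, h⟩ x‖ := by
      intro i
      by_cases h : v ∈ P i
      · by_contra! hx
        obtain ⟨n, hn, hvn⟩ := (hψ i).approx ⟨v, h⟩ r hr fun x => (hx x).2
        have : n = 0 := by simpa using hn
        rw [this] at hvn
        exact hlt (by simpa using hvn)
      · exact ⟨0, fun h' => absurd h' h⟩
    choose f hf using h1
    have h2 : ∀ᶠ i in (U : Filter ι), rep (f : (U : Filter ι).Germ V) i = f i :=
      Filter.Germ.coe_eq.1 (hrep (f : (U : Filter ι).Germ V))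
    obtain ⟨i, hi, hvi, h⟩ := (h2.and (hφ v (f : (U : Filter ι).Germ V))).exists
    rw [hi] at h
    exact absurd (hv (f : (U : Filter ι).Germ V)) (not_le.2 (h ▸ hf i hvi))

/-- The regular case: freeness from almost freeness. -/
theorem IsAleph1StronglyCompact.freeOver_top {κ : Cardinal.{u}} (hκ : IsAleph1StronglyCompact κ)
    (hreg : κ.IsRegular) (hV : #V = κ)
    (hfree : ∀ S : Set V, #S < κ → FreeOver ⊥ (closedSpan k S)) :
    FreeOver (⊥ : Submodule k V) ⊤ := by
  obtain ⟨U, hU, hUc⟩ := hκ.2 (Filter.cocardinal κ.out hreg)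
    (by
      have : (Filter.cocardinal κ.out hreg ⊓ Filter.principal Set.univ).NeBot :=
        Filter.cocardinal_inf_principal_neBot_iff.2 (by simp)
      simpa using this) inferInstance
  have hUc' := cardinalInterFilter_aleph_one_iff.1 hUc
  obtain ⟨g⟩ : Nonempty (κ.out ≃ V) := Cardinal.eq.1 (by rw [hV, mk_out])
  obtain ⟨r, hr, hord⟩ := exists_ord_eq κ.out
  have hIio : ∀ i, #{j | r j i} < κ := by
    intro i
    have := Ordinal.card_typein (r := r) i
    have h2 := Ordinal.typein_lt_type r i
    rw [← hord, mk_out, Cardinal.lt_ord] at h2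
    rw [this] at h2
    exact h2
  refine freeOver_top_of_ultrafilter U (fun i => closedSpan k (g '' {j | r j i}))
    (fun i => hfree _ (mk_image_le.trans_lt (hIio i))) fun v => ?_
  -- The exceptional indices lie in the initial segment up to the position of `v`, which has fewer
  -- than κ elements.
  refine hU ?_
  change #_ < κ
  refine lt_of_le_of_lt (mk_le_mk_of_subset (t := insert (g.symm v) {j | r j (g.symm v)}) ?_) ?_
  · intro i hi
    rcases trichotomous_of r i (g.symm v) with h | h | h
    · exact Or.inr h
    · exact Or.inl h
    · exact absurd (subset_closedSpan (k := k) (g '' {j | r j i})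
        ⟨g.symm v, h, g.apply_symm_apply v⟩) hi
  · exact (mk_insert_le).trans_lt (add_lt_of_lt hreg.aleph0_le (hIio _)
      (one_lt_aleph0.trans_le hreg.aleph0_le))

end Ultrafilter

/-! ### Cardinal bounds and boundedness below a successor -/

section Cardinality

theorem mk_iUnion_le_of_le {α ι : Type u} {μ : Cardinal.{u}} (hμ : ℵ₀ ≤ μ) (hι : #ι ≤ μ)
    {S : ι → Set α} (hS : ∀ i, #(S i) ≤ μ) : #(⋃ i, S i) ≤ μ :=
  (mk_iUnion_le S).trans (mul_le_of_le hμ hι (ciSup_le' hS))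

theorem mk_union_le_of_le {α : Type u} {μ : Cardinal.{u}} (hμ : ℵ₀ ≤ μ) {S T : Set α}
    (hS : #S ≤ μ) (hT : #T ≤ μ) : #(S ∪ T : Set α) ≤ μ :=
  (mk_union_le S T).trans (add_le_of_le hμ hS hT)

theorem Set.Countable.mk_le_of_aleph0_le {α : Type u} {μ : Cardinal.{u}} (hμ : ℵ₀ ≤ μ) {S : Set α}
    (hS : S.Countable) : #S ≤ μ :=
  (le_aleph0_iff_set_countable.2 hS).trans hμ

theorem mk_Iio_toType_succ_le {μ : Cardinal.{u}} (i : (Order.succ μ).ord.ToType) :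
    #(Set.Iio i) ≤ μ := by
  have h : #(Set.Iio i) < #(Order.succ μ).ord.ToType := mk_Iio_lt i (by simp)
  rw [mk_ord_toType] at h
  exact Order.lt_succ_iff.1 h

theorem exists_forall_lt_toType_succ {μ : Cardinal.{u}} (hμ : ℵ₀ ≤ μ)
    {S : Set (Order.succ μ).ord.ToType} (hS : #S ≤ μ) : ∃ j, ∀ i ∈ S, i < j := by
  by_contra! h
  have h1 : (Set.univ : Set (Order.succ μ).ord.ToType) ⊆ ⋃ i : S, Set.Iic (i : _) := by
    intro j _
    obtain ⟨i, hi, hji⟩ := h j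
    exact Set.mem_iUnion.2 ⟨⟨i, hi⟩, hji⟩
  have h2 : ∀ i : (Order.succ μ).ord.ToType, #(Set.Iic i) ≤ μ := by
    intro i
    rw [← Set.Iio_insert]
    exact mk_insert_le.trans (add_le_of_le hμ (mk_Iio_toType_succ_le i) (one_le_aleph0.trans hμ))
  have h3 := (mk_le_mk_of_subset h1).trans (mk_iUnion_le_of_le hμ hS fun i => h2 i)
  rw [mk_univ, mk_ord_toType] at h3
  exact absurd h3 (not_le.2 (Order.lt_succ μ))

end Cardinality

/-! ### Singular cardinals: pure sets and Shelah's compactness argument -/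

section Singular

variable {k : Type v} [NormedField k] {V : Type u} [NormedAddCommGroup V] [NormedSpace k V]

theorem FreeOver.exists_basis {S : Set V} (h : FreeOver ⊥ (closedSpan k S)) :
    ∃ E : Set V, E ⊆ closedSpan k S ∧ OrthonormalOver (⊥ : Submodule k V) E ∧
      S ⊆ closedSpan k E := by
  obtain ⟨E, hE, ho, hd⟩ := h
  rw [bot_sup_eq] at hd
  exact ⟨E, hE, ho, (subset_closedSpan S).trans hd⟩

theorem OrthonormalOver.freeOver_of_subset {E F : Set V}
    (ho : OrthonormalOver (⊥ : Submodule k V) E) (hF : F ⊆ E) :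
    FreeOver (closedSpan k F) (closedSpan k E) := by
  refine ⟨E \ F, Set.sdiff_subset.trans (subset_closedSpan E), OrthonormalOver.topologicalClosure
    ⟨fun e he => ho.1 e he.1, fun n hn b hb e => ?_⟩, ?_⟩
  · obtain ⟨a, ha, rfl⟩ := (Finsupp.mem_span_image_iff_linearCombination k
      (v := (id : V → V)) (s := F)).1 (by simpa using hn)
    by_cases he : e ∈ E \ F
    · have hae : a e = 0 := by
        by_contra hne
        exact he.2 (ha (by simpa using hne))
      have h1 := ho.2 0 (Submodule.zero_mem _) (a + b) (Submodule.add_mem _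
        (Finsupp.supported_mono hF ha) (Finsupp.supported_mono Set.sdiff_subset hb)) e
      rwa [Finsupp.add_apply, hae, zero_add, zero_add, map_add] at h1
    · have : b e = 0 := by
        by_contra hne
        exact he (hb (by simpa using hne))
      simp [this]
  · refine Submodule.topologicalClosure_mono (Submodule.span_le.2 fun e he => ?_)
    by_cases heF : e ∈ F
    · exact Submodule.mem_sup_left (subset_closedSpan F heF)
    · exact Submodule.mem_sup_right (Submodule.subset_span ⟨he, heF⟩)

variable (k) in
/-- The closed span of `A` is a free factor of the closed span of every set of cardinality at most
`μ` containing `A`. -/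
def IsPure (μ : Cardinal.{u}) (A : Set V) : Prop :=
  ∀ C, A ⊆ C → #C ≤ μ → FreeOver (closedSpan k A) (closedSpan k C)

variable [IsUltrametricDist k] [CompleteSpace k] [TopologicalSpace.SeparableSpace k]
  [IsUltrametricDist V]

/-- Otherwise every set of size at most μ above `A` has a non-free extension, and iterating gives a
chain of length μ⁺. A basis of its closed span cuts out, at some limit stage, a basis of that stage,
which is thus a free factor of everything above: a contradiction. -/
theorem exists_isPure {μ : Cardinal.{u}} (hμ : ℵ₀ ≤ μ)
    (hfree : ∀ S : Set V, #S ≤ Order.succ μ → FreeOver ⊥ (closedSpan k S))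
    {A : Set V} (hA : #A ≤ μ) : ∃ A', A ⊆ A' ∧ #A' ≤ μ ∧ IsPure k μ A' := by
  by_contra! hcon
  have hG : ∀ B : Set V, ∃ C, A ⊆ B → #B ≤ μ →
      B ⊆ C ∧ #C ≤ μ ∧ ¬ FreeOver (closedSpan k B) (closedSpan k C) := by
    intro B
    by_cases hB : A ⊆ B ∧ #B ≤ μ
    · have h1 := hcon B hB.1 hB.2
      rw [IsPure] at h1
      push Not at h1
      obtain ⟨C, hBC, hC, hCf⟩ := h1
      exact ⟨C, fun _ _ => ⟨hBC, hC, hCf⟩⟩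
    · exact ⟨∅, fun h1 h2 => absurd ⟨h1, h2⟩ hB⟩
  choose G hG using hG
  let T := (Order.succ μ).ord.ToType
  -- Only extensions of strictly earlier stages enter, so the chain is continuous at limits.
  let B : T → Set V := wellFounded_lt.fix fun i rec => A ∪ ⋃ j : Set.Iio i, G (rec j j.2)
  have hB : ∀ i, B i = A ∪ ⋃ j : Set.Iio i, G (B j) := fun i => wellFounded_lt.fix_eq _ i
  have hAB : ∀ i, A ⊆ B i := fun i => by rw [hB]; exact Set.subset_union_left
  have hBcard : ∀ i, #(B i) ≤ μ := by
    intro i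
    induction i using WellFoundedLT.induction with
    | ind i ih =>
      rw [hB]
      exact mk_union_le_of_le hμ hA (mk_iUnion_le_of_le hμ (mk_Iio_toType_succ_le i)
        fun j => (hG (B j) (hAB j) (ih j j.2)).2.1)
  have hGB : ∀ i j, i < j → G (B i) ⊆ B j := by
    intro i j hij
    rw [hB j]
    exact (Set.subset_iUnion (fun j : Set.Iio j => G (B j)) ⟨i, hij⟩).trans
      Set.subset_union_right
  have hmono : Monotone B := by
    intro i j hij
    rcases hij.lt_or_eq with h | rfl
    · exact (hG (B i) (hAB i) (hBcard i)).1.trans (hGB i j h)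
    · exact le_rfl
  obtain ⟨E, hE, ho, hdense⟩ := (hfree (⋃ i, B i) (mk_iUnion_le_of_le
    (hμ.trans (Order.le_succ μ)) (by simp [T]) fun i => (hBcard i).trans
      (Order.le_succ μ))).exists_basis
  -- Back and forth with countable supports: at most μ basis vectors span `B i`, and a bounded part
  -- of the chain spans those.
  have hstep : ∀ i, ∃ j, i < j ∧ ∃ F ⊆ E, B i ⊆ closedSpan k F ∧ F ⊆ closedSpan k (B j) := by
    intro i
    have hs : ∀ a : B i, ∃ s ⊆ E, s.Countable ∧ (a : V) ∈ closedSpan k s := fun a =>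
      exists_countable_mem_closedSpan (hdense (Set.mem_iUnion.2 ⟨i, a.2⟩))
    choose s hsE hsc hs using hs
    have ht : ∀ e : ⋃ a, s a, ∃ t ⊆ ⋃ i, B i, t.Countable ∧ (e : V) ∈ closedSpan k t := fun e =>
      exists_countable_mem_closedSpan (hE (Set.iUnion_subset hsE e.2))
    choose t htB htc ht using ht
    have hx : ∀ x : ⋃ e, t e, ∃ l, (x : V) ∈ B l := fun x =>
      Set.mem_iUnion.1 (Set.iUnion_subset htB x.2)
    choose l hl using hx
    have hcard : #(insert i (Set.range l) : Set T) ≤ μ := by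
      refine mk_insert_le.trans (add_le_of_le hμ (mk_range_le.trans ?_) (one_le_aleph0.trans hμ))
      refine mk_iUnion_le_of_le hμ ?_ fun e => (htc e).mk_le_of_aleph0_le hμ
      exact mk_iUnion_le_of_le hμ (hBcard i) fun a => (hsc a).mk_le_of_aleph0_le hμ
    obtain ⟨j, hj⟩ := exists_forall_lt_toType_succ hμ hcard
    refine ⟨j, hj i (Set.mem_insert _ _), ⋃ a, s a, Set.iUnion_subset hsE, fun a ha => ?_,
      fun e he => ?_⟩
    · exact closedSpan_mono (Set.subset_iUnion s ⟨a, ha⟩) (hs ⟨a, ha⟩)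
    · refine closedSpan_mono (fun x hxt => ?_) (ht ⟨e, he⟩)
      have hx : x ∈ ⋃ e, t e := Set.mem_iUnion.2 ⟨_, hxt⟩
      exact hmono (hj (l ⟨x, hx⟩) (Or.inr ⟨_, rfl⟩)).le (hl ⟨x, hx⟩)
  choose next hnext F hFE hBF hFB using hstep
  obtain ⟨i₀, -⟩ := exists_forall_lt_toType_succ hμ (S := (∅ : Set T)) (by simp)
  let ν : ℕ → T := fun n => next^[n] i₀
  have hν : ∀ n, ν (n + 1) = next (ν n) := fun n => Function.iterate_succ_apply' next n i₀
  have hνlt : ∀ n, ν n < ν (n + 1) := fun n => by rw [hν]; exact hnext _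
  have hub : {j : T | ∀ n, ν n ≤ j}.Nonempty := by
    obtain ⟨j, hj⟩ := exists_forall_lt_toType_succ hμ
      ((Set.countable_range ν).mk_le_of_aleph0_le hμ)
    exact ⟨j, fun n => (hj _ ⟨n, rfl⟩).le⟩
  -- At the supremum of the interleaved stages, `B m` and the chosen basis vectors have the same
  -- closed span.
  obtain ⟨m, hm, hmin⟩ := wellFounded_lt.has_min _ hub
  have hBm : B m = ⋃ n, B (ν n) := by
    refine Set.Subset.antisymm ?_ (Set.iUnion_subset fun n => hmono (hm n))
    rw [hB m]
    refine Set.union_subset ((hAB (ν 0)).trans (Set.subset_iUnion (fun n => B (ν n)) 0))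
      (Set.iUnion_subset fun j => ?_)
    obtain ⟨n, hn⟩ : ∃ n, (j : T) < ν n := by
      by_contra! h
      exact hmin j h j.2
    exact (hGB _ _ hn).trans (Set.subset_iUnion (fun n => B (ν n)) n)
  have hcs : closedSpan k (B m) = closedSpan k (⋃ n, F (ν n)) := by
    refine le_antisymm (closedSpan_le.2 ?_) (closedSpan_le.2 ?_)
    · rw [hBm]
      exact Set.iUnion_subset fun n => (hBF (ν n)).trans
        (closedSpan_mono (Set.subset_iUnion (fun n => F (ν n)) n))
    · refine Set.iUnion_subset fun n => (hFB (ν n)).trans (closedSpan_mono ?_)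
      rw [← hν]
      exact hmono (hm _)
  have hfac := ho.freeOver_of_subset (Set.iUnion_subset fun n => hFE (ν n))
  rw [← hcs] at hfac
  obtain ⟨m', hm'⟩ := exists_forall_lt_toType_succ hμ (S := {m})
    (by simpa using one_le_aleph0.trans hμ)
  obtain ⟨h1, -, h3⟩ := hG (B m) (hAB m) (hBcard m)
  refine h3 (hfac.of_le (closedSpan_mono h1) (closedSpan_le.2 ?_))
  exact (hGB m m' (hm' m rfl)).trans ((Set.subset_iUnion B m').trans hdense)

/-- Singular compactness: a space all of whose small closed subspaces are free is free. -/
theorem freeOver_top_of_isSingular {κ : Cardinal.{u}} (hκ : κ.IsSingular) (hV : #V = κ)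
    (hfree : ∀ S : Set V, #S < κ → FreeOver ⊥ (closedSpan k S)) :
    FreeOver (⊥ : Submodule k V) ⊤ := by
  obtain ⟨g⟩ : Nonempty (κ.ord.ToType ≃ V) := Cardinal.eq.1 (by rw [hV, mk_ord_toType])
  obtain ⟨Λ, hΛ, hΛcard⟩ := Order.exists_cof_eq κ.ord.ToType
  rw [Ordinal.cof_toType] at hΛcard
  have hΛκ : #Λ < κ := hΛcard ▸ hκ.cof_ord_lt
  let D : Λ → Set V := fun i => g '' Set.Iic (i : κ.ord.ToType)
  have hDκ : ∀ i, #(D i) < κ := by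
    intro i
    refine mk_image_le.trans_lt ?_
    rw [← Set.Iio_insert]
    refine mk_insert_le.trans_lt (add_lt_of_lt hκ.aleph0_le ?_ (by simpa using hκ.natCast_lt 1))
    simpa using mk_Iio_lt (i : κ.ord.ToType) (by simp)
  -- Including `#Λ` leaves room in each row `i` for supports relative to all the other rows.
  let c : Λ → Cardinal.{u} := fun i => max (max ℵ₀ #Λ) #(D i)
  have hc0 : ∀ i, ℵ₀ ≤ c i := fun i => (le_max_left _ _).trans (le_max_left _ _)
  have hcΛ : ∀ i, #Λ ≤ c i := fun i => (le_max_right _ _).trans (le_max_left _ _)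
  have hcmono : Monotone c := fun i j hij => max_le_max le_rfl
    (mk_le_mk_of_subset (Set.image_mono (Set.Iic_subset_Iic.2 hij)))
  have haleph : ℵ₀ < κ := lt_of_le_of_ne hκ.aleph0_le fun h => not_isSingular_aleph0 (h ▸ hκ)
  have hcκ : ∀ i, c i < κ := fun i => max_lt (max_lt haleph hΛκ) (hDκ i)
  have hpure : ∀ i (A : Set V), #A ≤ c i → ∃ A', A ⊆ A' ∧ #A' ≤ c i ∧ IsPure k (c i) A' :=
    fun i A hA => exists_isPure (hc0 i) (fun S hS => hfree S
      (hS.trans_lt (hκ.isSuccLimit.succ_lt (hcκ i)))) hA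
  let good : Λ → Set V × Set V → Prop := fun i p => #p.1 ≤ c i ∧ IsPure k (c i) p.1 ∧
    p.2 ⊆ closedSpan k p.1 ∧ OrthonormalOver (⊥ : Submodule k V) p.2 ∧ p.1 ⊆ closedSpan k p.2
  have hinit : ∀ i, ∃ p, good i p ∧ D i ⊆ p.1 := by
    intro i
    obtain ⟨A, hDA, hA, hAp⟩ := hpure i (D i) (le_max_right _ _)
    obtain ⟨E, hE, ho, hAE⟩ := (hfree A (hA.trans_lt (hcκ i))).exists_basis
    exact ⟨(A, E), ⟨hA, hAp, hE, ho, hAE⟩, hDA⟩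
  -- One stage of the matrix: bases grow, rows become increasing, and if a vector of row `i` is
  -- spanned by the basis of row `j`, its support there is thrown into row `i`.
  have hstep : ∀ σ : {σ : Λ → Set V × Set V // ∀ i, good i (σ i)},
      ∃ τ : {σ : Λ → Set V × Set V // ∀ i, good i (σ i)}, ∀ i, (σ.1 i).2 ⊆ (τ.1 i).2 ∧
        (∀ j ≤ i, (σ.1 j).1 ⊆ (τ.1 i).1) ∧
        ∀ j, ∀ a ∈ (σ.1 i).1, a ∈ closedSpan k (σ.1 j).2 →
          ∃ s ⊆ (σ.1 j).2, s ⊆ (τ.1 i).1 ∧ a ∈ closedSpan k s := by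
    rintro ⟨σ, hσ⟩
    have hs : ∀ (j : Λ) (a : V), ∃ s ⊆ (σ j).2, s.Countable ∧
        (a ∈ closedSpan k (σ j).2 → a ∈ closedSpan k s) := by
      intro j a
      by_cases ha : a ∈ closedSpan k (σ j).2
      · obtain ⟨s, hs, hsc, has⟩ := exists_countable_mem_closedSpan ha
        exact ⟨s, hs, hsc, fun _ => has⟩
      · exact ⟨∅, Set.empty_subset _, Set.countable_empty, fun h => absurd h ha⟩
    choose s hsσ hsc hs using hs
    have hnext : ∀ i, ∃ p : Set V × Set V, good i p ∧ (σ i).2 ⊆ p.2 ∧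
        (⋃ j : Set.Iic i, (σ j).1) ∪ ⋃ j, ⋃ a : (σ i).1, s j a ⊆ p.1 := by
      intro i
      obtain ⟨h1, h2, h3, h4, h5⟩ := hσ i
      obtain ⟨A, hA, hAc, hAp⟩ := hpure i ((⋃ j : Set.Iic i, (σ j).1) ∪ ⋃ j, ⋃ a : (σ i).1, s j a)
        (mk_union_le_of_le (hc0 i)
          (mk_iUnion_le_of_le (hc0 i) ((mk_set_le _).trans (hcΛ i))
            fun j => (hσ j).1.trans (hcmono j.2))
          (mk_iUnion_le_of_le (hc0 i) (hcΛ i) fun j => mk_iUnion_le_of_le (hc0 i) h1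
            fun a => (hsc j a).mk_le_of_aleph0_le (hc0 i)))
      have hσA : (σ i).1 ⊆ A := (Set.subset_iUnion (fun j : Set.Iic i => (σ j).1)
        ⟨i, le_refl i⟩).trans (Set.subset_union_left.trans hA)
      -- Purity of the old set, applied to the new one, is what lets the old basis be extended
      -- rather than replaced.
      obtain ⟨E, hE, ho, hd⟩ := h2 A hσA hAc
      refine ⟨(A, (σ i).2 ∪ E), ⟨hAc, hAp, Set.union_subset (h3.trans (closedSpan_mono hσA)) hE,
        h4.union h3 bot_le ho, (subset_closedSpan A).trans (hd.trans ?_)⟩,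
        Set.subset_union_left, hA⟩
      refine Submodule.topologicalClosure_minimal _ (sup_le (closedSpan_le.2 ?_)
        (Submodule.span_le.2 ?_)) (closedSpan_isClosed _)
      · exact h5.trans (closedSpan_mono Set.subset_union_left)
      · exact Set.subset_union_right.trans (subset_closedSpan _)
    choose τ hτ hτ2 hτ1 using hnext
    refine ⟨⟨τ, hτ⟩, fun i => ⟨hτ2 i, fun j hj => ?_, fun j a ha haj => ?_⟩⟩
    · exact (Set.subset_iUnion (fun j : Set.Iic i => (σ j).1) ⟨j, hj⟩).trans
        (Set.subset_union_left.trans (hτ1 i))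
    · refine ⟨s j a, hsσ j a, Set.Subset.trans ?_ (Set.subset_union_right.trans (hτ1 i)),
        hs j a haj⟩
      exact (Set.subset_iUnion (fun a : (σ i).1 => s j a) ⟨a, ha⟩).trans
        (Set.subset_iUnion (fun j => ⋃ a : (σ i).1, s j a) j)
  choose p₀ hp₀ hDp₀ using hinit
  choose next hnext2 hnext1 hnexts using hstep
  let σ : ℕ → {σ : Λ → Set V × Set V // ∀ i, good i (σ i)} := fun n => next^[n] ⟨p₀, hp₀⟩
  have hσ : ∀ n, σ (n + 1) = next (σ n) := fun n => Function.iterate_succ_apply' next n _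
  have hmono2 : ∀ i, Monotone fun n => ((σ n).1 i).2 := fun i =>
    monotone_nat_of_le_succ fun n => by rw [hσ]; exact hnext2 (σ n) i
  let A : Λ → Set V := fun i => ⋃ n, ((σ n).1 i).1
  let B : Λ → Set V := fun i => ⋃ n, ((σ n).1 i).2
  have hBo : ∀ i, OrthonormalOver (⊥ : Submodule k V) (B i) := fun i =>
    OrthonormalOver.iUnion (hmono2 i).directed_le fun n => ((σ n).2 i).2.2.2.1
  have hAA : ∀ i j, j ≤ i → A j ⊆ A i := by
    intro i j hij
    refine Set.iUnion_subset fun n => ?_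
    refine Set.Subset.trans ?_ (Set.subset_iUnion (fun n => ((σ n).1 i).1) (n + 1))
    rw [hσ]
    exact hnext1 (σ n) i j hij
  have hcs : ∀ i, closedSpan k (A i) = closedSpan k (B i) := by
    intro i
    refine le_antisymm (closedSpan_le.2 ?_) (closedSpan_le.2 ?_)
    · exact Set.iUnion_subset fun n => ((σ n).2 i).2.2.2.2.trans
        (closedSpan_mono (Set.subset_iUnion (fun n => ((σ n).1 i).2) n))
    · exact Set.iUnion_subset fun n => ((σ n).2 i).2.2.1.trans
        (closedSpan_mono (Set.subset_iUnion (fun n => ((σ n).1 i).1) n))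
  -- An element of a lower row `j` enters row `i`; its support in the basis of row `i` enters row
  -- `j` one stage later. So part of the basis `B i` spans all lower rows, making them a free
  -- factor.
  have hlink : ∀ i, closedSpan k (⋃ j < i, A j) = closedSpan k (B i ∩ ⋃ j < i, A j) := by
    intro i
    refine le_antisymm (closedSpan_le.2 ?_) (closedSpan_mono Set.inter_subset_right)
    refine Set.iUnion₂_subset fun j hj => Set.iUnion_subset fun n a ha => ?_
    have ha1 : a ∈ ((σ (n + 1)).1 i).1 := by
      rw [hσ]; exact hnext1 (σ n) i j hj.le ha
    have ha2 : a ∈ ((σ (n + 1)).1 j).1 := by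
      rw [hσ]; exact hnext1 (σ n) j j le_rfl ha
    obtain ⟨s, hs1, hs2, has⟩ := hnexts (σ (n + 1)) j i a ha2 (((σ (n + 1)).2 i).2.2.2.2 ha1)
    rw [← hσ] at hs2
    refine closedSpan_mono (Set.subset_inter ?_ ?_) has
    · exact hs1.trans (Set.subset_iUnion (fun n => ((σ n).1 i).2) (n + 1))
    · exact (hs2.trans (Set.subset_iUnion (fun n => ((σ n).1 j).1) (n + 2))).trans
        (Set.subset_iUnion₂ (s := fun j (_ : j < i) => A j) j hj)
  have hfinal := FreeOver.chain (k := k) ∅ A fun i => by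
    have hle : (⋃ j ≤ i, A j) = A i := Set.Subset.antisymm
      (Set.iUnion₂_subset fun j hj => hAA i j hj)
      (Set.subset_iUnion₂ (s := fun j (_ : j ≤ i) => A j) i le_rfl)
    rw [Set.empty_union, Set.empty_union, hle, hcs, hlink]
    exact (hBo i).freeOver_of_subset Set.inter_subset_left
  have htop : closedSpan k (∅ ∪ ⋃ i, A i) = ⊤ := by
    refine eq_top_iff.2 fun v _ => subset_closedSpan _ (Or.inr ?_)
    obtain ⟨i, hi, hvi⟩ := hΛ (g.symm v)
    refine Set.mem_iUnion.2 ⟨⟨i, hi⟩, Set.mem_iUnion.2 ⟨0, hDp₀ ⟨i, hi⟩ ⟨g.symm v, hvi, ?_⟩⟩⟩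
    exact g.apply_symm_apply v
  have hbot : closedSpan k (∅ : Set V) = ⊥ := by
    rw [closedSpan, Submodule.span_empty]
    exact IsClosed.submodule_topologicalClosure_eq isClosed_singleton
  rwa [htop, hbot] at hfinal

end Singular

/-! ### Separability of ℂ_p and the main theorem -/

section Main

/-- Continuity of roots: perturb the minimal polynomial over ℚ_p to a monic one with rational
coefficients. -/
theorem PadicAlgCl.dense_setOf_isAlgebraic_rat (p : ℕ) [Fact p.Prime] :
    Dense {x : PadicAlgCl p | IsAlgebraic ℚ x} := by
  intro a
  rw [Metric.mem_closure_iff]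
  intro ε hε
  have hint : IsIntegral ℚ_[p] a := (Algebra.IsAlgebraic.isAlgebraic a).isIntegral
  set f := minpoly ℚ_[p] a with hf
  have hn : f.natDegree ≠ 0 := (minpoly.natDegree_pos hint).ne'
  set M := max ‖a‖ 1 with hM
  have hM0 : 0 < M := lt_max_of_lt_right one_pos
  have hdense : DenseRange (algebraMap ℚ ℚ_[p]) :=
    Padic.denseRange_ratCast p
  -- Chosen so that the root-distance bound, an `n`-th root (`n` the degree) times `M`, becomes
  -- exactly `ε`.
  have hδ : 0 < (ε / M) ^ f.natDegree / (f.natDegree + 1) := by positivity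
  obtain ⟨g, hg, hdeg, hcoeff⟩ :=
    Polynomial.exists_monic_and_natDegree_eq_and_norm_map_algebraMap_coeff_sub_lt hdense
      (minpoly.monic hint) hδ
  obtain ⟨b, hb, hab⟩ := Polynomial.exists_aroots_norm_sub_lt_of_norm_coeff_sub_lt hδ
    (minpoly.aeval ℚ_[p] a) (minpoly.monic hint) (hg.map _) (by simp [hdeg]) hcoeff
    (IsAlgClosed.splits _)
  refine ⟨b, ?_, ?_⟩
  · refine ⟨g, hg.ne_zero, ?_⟩
    have h1 := (Polynomial.mem_aroots.1 hb).2
    rwa [Polynomial.aeval_map_algebraMap] at h1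
  · rw [dist_eq_norm]
    refine hab.trans_eq ?_
    rw [mul_div_cancel₀ _ (by positivity), Real.pow_rpow_inv_natCast (by positivity) hn,
      div_mul_cancel₀ _ hM0.ne']

instance PadicComplex.separableSpace (p : ℕ) [Fact p.Prime] :
    TopologicalSpace.SeparableSpace ℂ_[p] :=
  have : TopologicalSpace.SeparableSpace (PadicAlgCl p) :=
    ⟨_, Algebraic.countable ℚ (PadicAlgCl p), PadicAlgCl.dense_setOf_isAlgebraic_rat p⟩
  inferInstance

theorem mainTheorem2 (p : ℕ) [Fact p.Prime] (k : Subfield ℂ_[p])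
    (hk : IsClosed (k : Set ℂ_[p])) (V : Type u) [NormedAddCommGroup V] [NormedSpace k V]
    [IsUltrametricDist V] [CompleteSpace V] (hV : #V = banachRank k V)
    (hrank : IsAleph1StronglyCompact (banachRank k V)) :
    IsFreeBanach k V ↔ IsAlmostFreeBanach k V := by
  have : CompleteSpace k := hk.completeSpace_coe
  -- Unlike separability, second countability passes to arbitrary subspaces, hence to `k`.
  have : SecondCountableTopology ℂ_[p] := UniformSpace.secondCountable_of_separable ℂ_[p]
  refine ⟨fun h S _ => h.submodule (closedSpan_isClosed S), fun h => ?_⟩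
  have hfree : ∀ S : Set V, #S < banachRank k V → FreeOver ⊥ (closedSpan k S) :=
    fun S hS => (h S hS).freeOver_of_submodule
  rcases isRegular_or_isSingular (aleph0_le_aleph 1 |>.trans hrank.1) with hreg | hsing
  · exact (hrank.freeOver_top hreg hV hfree).isFreeBanach
  · exact (freeOver_top_of_isSingular hsing hV hfree).isFreeBanach

end Main
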